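/- Let $K$ be a field, $a,b\in\mathbb Z$, and let $(\mathcal A,\cdot,[\ ,\ ],d)$ be a differential graded $(a,b)$-algebra over $K$: $\mathcal A=\bigoplus_{i\in\mathbb Z}\mathcal A_i$ is a graded $K$-vector space with bilinear operations $\cdot$ of degree $a$ and $[\ ,\ ]$ of degree $b$ and a linear map $d$ of degree $1$ such that, for all homogeneous $\alpha,\beta,\gamma$ of degrees $|\alpha|,|\beta|,|\gamma|$, $$\alpha\cdot\beta=(-1)^{(|\alpha|+a)(|\beta|+a)}\beta\cdot\alpha,\qquad \alpha\cdot(\beta\cdot\gamma)=(\alpha\cdot\beta)\cdot\gamma,\qquad [\alpha,\beta]=-(-1)^{(|\alpha|+b)(|\beta|+b)}[\beta,\alpha],$$ $$(-1)^{(|\alpha|+b)(|\gamma|+b)}[[\alpha,\beta],\gamma]+(-1)^{(|\beta|+b)(|\alpha|+b)}[[\beta,\gamma],\alpha]+(-1)^{(|\gamma|+b)(|\beta|+b)}[[\gamma,\alpha],\beta]=0,$$ $$[\alpha,\beta\cdot\gamma]=[\alpha,\beta]\cdot\gamma+(-1)^{(|\beta|+a)(|\alpha|+b)}\beta\cdot[\alpha,\gamma],\qquad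 d\circ d=0,$$ $$d(\alpha\cdot\beta)=d\alpha\cdot\beta+(-1)^{|\alpha|+a}\alpha\cdot d\beta,\qquad d([\alpha,\beta])=[d\alpha,\beta]+(-1)^{|\alpha|+b}[\alpha,d\beta].$$ For a graded space $V$ let $V[k]$ be the same space with $V[k]_i=V_{i+k}$. On $\mathcal A[-a+1]$, write $dg(\alpha)=|\alpha|+a-1$, $\mu(\alpha,\beta)=(-1)^{dg(\alpha)}\alpha\cdot\beta$ and $\ell(\alpha,\beta)=(-1)^{(b-a+1)dg(\alpha)}[\alpha,\beta]$. Let $Bat(p,q)\subset S_{p+q}$ be the set of $\sigma$ with $\sigma(1)<\dots<\sigma(p)$ and $\sigma(p+1)<\dots<\sigma(p+q)$, let $\varepsilon_\alpha(\sigma^{-1})$ be the signature of the permutation that $\alpha_1\cdots\alpha_n\mapsto\alpha_{\sigma^{-1}(1)}\cdots\alpha_{\sigma^{-1}(n)}$ induces on the letters of odd degree $dg$, and let $$bat_{p,q}(\alpha_1\otimes\dots\otimes\alpha_p,\ \alpha_{p+1}\otimes\dots\otimes\alpha_{p+q})=\sum_{\sigma\in Bat(p,q)}\varepsilon_\alpha(\sigma^{-1})\,\alpha_{\sigma^{-1}(1)}\otimes\dots\otimes\alpha_{\sigma^{-1}(p+q)}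 .$$ Let $\mathcal H=\bigoplus_{n\ge1}\Big(\bigotimes^n\mathcal A[-a+1]\Big/\sum_{p+q=n,\ p,q\ge1}\mathrm{Im}(bat_{p,q})\Big)$, write $\alpha_1\underline\otimes\cdots\underline\otimes\alpha_n$ for the class of $\alpha_1\otimes\dots\otimes\alpha_n$, and grade $\mathcal H$ by $dg(\alpha_1\underline\otimes\cdots\underline\otimes\alpha_n)=\sum_i dg(\alpha_i)$. Then the following holds. The formulas below, for homogeneous $\alpha_i$ and $n,p,q\ge1$, give well-defined linear, respectively bilinear, maps $D=d_1+\mu_1:\mathcal H\to\mathcal H$ and $\ell_2:\mathcal H\times\mathcal H\to\mathcal H$: $$d_1(\alpha_1\underline\otimes\cdots\underline\otimes\alpha_n)=\sum_{1\le k\le n}(-1)^{\sum_{i<k}dg(\alpha_i)}\alpha_1\underline\otimes\cdots\underline\otimes d(\alpha_k)\underline\otimes\cdots\underline\otimes\alpha_n,$$ $$\mu_1(\alpha_1\underline\otimes\cdots\underline\otimes\alpha_n)=\sum_{1\le k<n}(-1)^{\sum_{i<k}dg(\alpha_i)}\alpha_1\underline\otimes\cdots\underline\otimes\mu(\alpha_k,\alpha_{k+1})\underline\otimes\cdots\underline\otimes\alpha_n,$$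 and, for $X=\alpha_1\underline\otimes\cdots\underline\otimes\alpha_p$ and $Y=\alpha_{p+1}\underline\otimes\cdots\underline\otimes\alpha_{p+q}$, $$\ell_2(X,Y)=\sum_{\substack{\sigma\in Bat(p,q),\ k\\ \sigma^{-1}(k)\le p<\sigma^{-1}(k+1)}}\varepsilon_\alpha(\sigma^{-1})(-1)^{(b-a+1)\sum_{s<k}dg(\alpha_{\sigma^{-1}(s)})}\,\alpha_{\sigma^{-1}(1)}\underline\otimes\cdots\underline\otimes\ell(\alpha_{\sigma^{-1}(k)},\alpha_{\sigma^{-1}(k+1)})\underline\otimes\cdots\underline\otimes\alpha_{\sigma^{-1}(p+q)} .$$ Consider $\mathcal H[a-b-1]$, in which the degree of a homogeneous $X\in\mathcal H$ is $x'=dg(X)-a+b+1$, and let $\ell'_2$ be the bilinear map with $\ell'_2(X,Y)=(-1)^{(a-b-1)x'}\ell_2(X,Y)$ for $X$ homogeneous. Then $(\mathcal H[a-b-1],\ell'_2,D)$ is a differential graded Lie algebra: $\mathcal H[a-b-1]$ is a graded vector space, $\ell'_2$ has degree $0$, $D$ has degree $1$, $D\circ D=0$, and for all homogeneous $X,Y,Z$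 of degrees $x',y',z'$ in $\mathcal H[a-b-1]$: (i) $\ell'_2(X,Y)=-(-1)^{x'y'}\ell'_2(Y,X)$; (ii) $(-1)^{x'z'}\ell'_2(\ell'_2(X,Y),Z)+(-1)^{y'x'}\ell'_2(\ell'_2(Y,Z),X)+(-1)^{z'y'}\ell'_2(\ell'_2(Z,X),Y)=0$; (iii) $D(\ell'_2(X,Y))=\ell'_2(D(X),Y)+(-1)^{x'}\ell'_2(X,D(Y))$. -/

import Mathlib

namespace ABHomotopy

variable {K : Type*} [Field K]

/-- A graded space `V = ⨁ᵢ Vᵢ` is given by its family of homogeneous components. The shifted space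
`V[k]` is the same space with `V[k]ᵢ = Vᵢ₊ₖ`. -/
def shift {V : Type*} [AddCommGroup V] [Module K V] (k : ℤ) (𝒱 : ℤ → Submodule K V) :
    ℤ → Submodule K V :=
  fun i => 𝒱 (i + k)

/-- Differential graded Lie algebra: bracket of degree `0`, differential of degree `1`. -/
structure IsDGLieAlgebra {V : Type*} [AddCommGroup V] [Module K V] (𝒱 : ℤ → Submodule K V)
    (br : V →ₗ[K] V →ₗ[K] V) (D : V →ₗ[K] V) : Prop where
  isInternal : DirectSum.IsInternal 𝒱
  br_mem : ∀ {x y : ℤ} {X Y : V}, X ∈ 𝒱 x → Y ∈ 𝒱 y → br X Y ∈ 𝒱 (x + y)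
  D_mem : ∀ {x : ℤ} {X : V}, X ∈ 𝒱 x → D X ∈ 𝒱 (x + 1)
  antisymm : ∀ {x y : ℤ} {X Y : V}, X ∈ 𝒱 x → Y ∈ 𝒱 y →
    br X Y = -((x * y).negOnePow • br Y X)
  jacobi : ∀ {x y z : ℤ} {X Y Z : V}, X ∈ 𝒱 x → Y ∈ 𝒱 y → Z ∈ 𝒱 z →
    (x * z).negOnePow • br (br X Y) Z + (y * x).negOnePow • br (br Y Z) X
      + (z * y).negOnePow • br (br Z X) Y = 0
  D_br : ∀ {x y : ℤ} {X Y : V}, X ∈ 𝒱 x → Y ∈ 𝒱 y →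
    D (br X Y) = br (D X) Y + x.negOnePow • br X (D Y)
  D_D : ∀ X : V, D (D X) = 0

variable {A : Type*} [AddCommGroup A] [Module K A]

/-- Differential graded `(a,b)`-algebra: a product of degree `a`, a bracket of degree `b` and a
differential of degree `1` on the graded space `A`, such that `A[-a]` is a graded commutative
associative algebra, `A[-b]` is a graded Lie algebra, the bracket satisfies the Leibniz identity,
and `d` is a derivation of both operations with `d ∘ d = 0`. -/
structure IsDGABAlgebra (a b : ℤ) (𝒜 : ℤ → Submodule K A)
    (mul bra : A →ₗ[K] A →ₗ[K] A) (d : A →ₗ[K] A) : Prop where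
  isInternal : DirectSum.IsInternal 𝒜
  mul_mem : ∀ {i j : ℤ} {α β : A}, α ∈ 𝒜 i → β ∈ 𝒜 j → mul α β ∈ 𝒜 (i + j + a)
  bra_mem : ∀ {i j : ℤ} {α β : A}, α ∈ 𝒜 i → β ∈ 𝒜 j → bra α β ∈ 𝒜 (i + j + b)
  d_mem : ∀ {i : ℤ} {α : A}, α ∈ 𝒜 i → d α ∈ 𝒜 (i + 1)
  mul_comm : ∀ {i j : ℤ} {α β : A}, α ∈ 𝒜 i → β ∈ 𝒜 j →
    mul α β = ((i + a) * (j + a)).negOnePow • mul β α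
  mul_assoc : ∀ α β γ : A, mul α (mul β γ) = mul (mul α β) γ
  bra_antisymm : ∀ {i j : ℤ} {α β : A}, α ∈ 𝒜 i → β ∈ 𝒜 j →
    bra α β = -(((i + b) * (j + b)).negOnePow • bra β α)
  jacobi : ∀ {i j k : ℤ} {α β γ : A}, α ∈ 𝒜 i → β ∈ 𝒜 j → γ ∈ 𝒜 k →
    ((i + b) * (k + b)).negOnePow • bra (bra α β) γ
      + ((j + b) * (i + b)).negOnePow • bra (bra β γ) α
      + ((k + b) * (j + b)).negOnePow • bra (bra γ α) β = 0
  leibniz : ∀ {i j k : ℤ} {α β γ : A}, α ∈ 𝒜 i → β ∈ 𝒜 j → γ ∈ 𝒜 k →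
    bra α (mul β γ) = mul (bra α β) γ + ((j + a) * (i + b)).negOnePow • mul β (bra α γ)
  d_d : ∀ α : A, d (d α) = 0
  d_mul : ∀ {i j : ℤ} {α β : A}, α ∈ 𝒜 i → β ∈ 𝒜 j →
    d (mul α β) = mul (d α) β + (i + a).negOnePow • mul α (d β)
  d_bra : ∀ {i j : ℤ} {α β : A}, α ∈ 𝒜 i → β ∈ 𝒜 j →
    d (bra α β) = bra (d α) β + (i + b).negOnePow • bra α (d β)

/-- Homogeneous elements of `A`, together with their degree. -/
abbrev HomEl (𝒜 : ℤ → Submodule K A) : Type _ := Σ i : ℤ, 𝒜 i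

section Words

variable (a : ℤ) {𝒜 : ℤ → Submodule K A}

/-- The degree `dg(α) = |α| + a - 1` in `A[-a+1]`. -/
def dg (x : HomEl 𝒜) : ℤ := x.1 + a - 1

/-- The total degree `dg(α₁) + ⋯ + dg(αₙ)` of a word. -/
def degWord {n : ℕ} (w : Fin n → HomEl 𝒜) : ℤ := ∑ i, dg a (w i)

/-- `dg(α₁) + ⋯ + dg(αₖ₋₁)`: the degree of the part of the word strictly before position `k`. -/
def degBefore {n : ℕ} (w : Fin n → HomEl 𝒜) (k : Fin n) : ℤ := ∑ s ∈ Finset.Iio k, dg a (w s)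

/-- `μ(α,β) = (-1)^{dg α} α·β`. -/
def muA (mul : A →ₗ[K] A →ₗ[K] A) (x y : HomEl 𝒜) : A :=
  (dg a x).negOnePow • mul x.2 y.2

/-- `ℓ(α,β) = (-1)^{(b-a+1) dg α} [α,β]`. -/
def ellA (b : ℤ) (bra : A →ₗ[K] A →ₗ[K] A) (x y : HomEl 𝒜) : A :=
  ((b - a + 1) * dg a x).negOnePow • bra x.2 y.2

/-- The underlying list of vectors of a word of homogeneous elements. -/
def letters {n : ℕ} (w : Fin n → HomEl 𝒜) : List A := List.ofFn fun i => ((w i).2 : A)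

/-- Replace the `r` letters of the word `w` at positions `k, …, k + r - 1` (counted from `0`) by the
single letter `m`. -/
def splice {n : ℕ} (w : Fin n → HomEl 𝒜) (k r : ℕ) (m : A) : List A :=
  (letters w).take k ++ m :: (letters w).drop (k + r)

/-- The `(p,q)`-shuffles: permutations `σ` of `p + q` letters with `σ(1) < ⋯ < σ(p)` and
`σ(p+1) < ⋯ < σ(p+q)`. -/
def Bat (p q : ℕ) : Finset (Equiv.Perm (Fin (p + q))) :=
  {σ | (∀ i j : Fin (p + q), i < j → (j : ℕ) < p → σ i < σ j) ∧
       (∀ i j : Fin (p + q), i < j → p ≤ (i : ℕ) → σ i < σ j)}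

/-- The Koszul sign `ε(α₁ … αₙ ; α_{σ⁻¹(1)} … α_{σ⁻¹(n)})`, i.e. the signature of the permutation
induced on the letters of odd degree. -/
def koszul {n : ℕ} (w : Fin n → HomEl 𝒜) (σ : Equiv.Perm (Fin n)) : ℤˣ :=
  ∏ ij ∈ (Finset.univ : Finset (Fin n × Fin n)) with ij.1 < ij.2 ∧ σ ij.2 < σ ij.1,
    (dg a (w ij.1) * dg a (w ij.2)).negOnePow

/-- The rearranged word `α_{σ⁻¹(1)}, …, α_{σ⁻¹(n)}`. -/
def permWord {n : ℕ} (σ : Equiv.Perm (Fin n)) (w : Fin n → HomEl 𝒜) : Fin n → HomEl 𝒜 :=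
  fun i => w (σ⁻¹ i)

end Words

section Space

variable (K) in
/-- The tensor `α₁ ⊗ ⋯ ⊗ αₙ` in the tensor algebra of `A`. -/
def tens (l : List A) : TensorAlgebra K A := (l.map (TensorAlgebra.ι K)).prod

variable (K A) in
/-- `⨂⁺ A = ⨁_{n ≥ 1} ⨂ⁿ A`, as a subspace of the tensor algebra. -/
def Tplus : Submodule K (TensorAlgebra K A) :=
  ⨆ n : ℕ, LinearMap.range (TensorAlgebra.ι K (M := A)) ^ (n + 1)

theorem tens_mem_pow (l : List A) :
    tens K l ∈ LinearMap.range (TensorAlgebra.ι K (M := A)) ^ l.length := by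
  induction l with
  | nil => simp [tens]
  | cons x l ih =>
    rw [List.length_cons, pow_succ']
    have h : tens K (x :: l) = TensorAlgebra.ι K x * tens K l := by simp [tens]
    rw [h]
    exact Submodule.mul_mem_mul ⟨x, rfl⟩ ih

theorem tens_cons_mem (x : A) (l : List A) : tens K (x :: l) ∈ Tplus K A :=
  Submodule.mem_iSup_of_mem l.length (tens_mem_pow (x :: l))

variable (a : ℤ) (𝒜 : ℤ → Submodule K A)

/-- The shuffle product `bat_{p,q}(α, β)` of two words, in the tensor algebra. -/
def bat {𝒜 : ℤ → Submodule K A} {p q : ℕ} (u : Fin p → HomEl 𝒜) (v : Fin q → HomEl 𝒜) :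
    TensorAlgebra K A :=
  ∑ σ ∈ Bat p q, koszul a (Fin.append u v) σ • tens K (letters (permWord σ (Fin.append u v)))

/-- The sum of the images of all the maps `bat_{p,q}`, `p, q ≥ 1`. -/
def shuffles : Submodule K (TensorAlgebra K A) :=
  Submodule.span K {t | ∃ (p q : ℕ) (u : Fin p → HomEl 𝒜) (v : Fin q → HomEl 𝒜),
    1 ≤ p ∧ 1 ≤ q ∧ t = bat a u v}

/-- The space `H = ⨁_{n ≥ 1} ⨂ⁿ(A[-a+1]) / ∑_{p+q=n} Im bat_{p,q}`. -/
abbrev H : Type _ := Tplus K A ⧸ (shuffles a 𝒜).submoduleOf (Tplus K A)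

/-- The class in `H` of the tensor `α₁ ⊗ ⋯ ⊗ αₙ`, `n ≥ 1` (and `0` for the empty list). -/
def cls : List A → H a 𝒜
  | [] => 0
  | x :: l => Submodule.Quotient.mk ⟨tens K (x :: l), tens_cons_mem x l⟩

/-- The grading of `H`: `dg(α₁ ⊗ ⋯ ⊗ αₙ) = dg(α₁) + ⋯ + dg(αₙ)`. -/
def gradH (x : ℤ) : Submodule K (H a 𝒜) :=
  Submodule.span K {X | ∃ (n : ℕ) (w : Fin n → HomEl 𝒜),
    1 ≤ n ∧ degWord a w = x ∧ X = cls a 𝒜 (letters w)}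

variable {𝒜}

/-- `d₁(α₁ ⊗ ⋯ ⊗ αₙ) = ∑ₖ (-1)^{∑_{i<k} dg αᵢ} α₁ ⊗ ⋯ ⊗ d(αₖ) ⊗ ⋯ ⊗ αₙ`. -/
def dOne (d : A →ₗ[K] A) {n : ℕ} (w : Fin n → HomEl 𝒜) : H a 𝒜 :=
  ∑ k : Fin n, (degBefore a w k).negOnePow • cls a 𝒜 (splice w k 1 (d (w k).2))

/-- `μ₁(α₁ ⊗ ⋯ ⊗ αₙ) = ∑_{k<n} (-1)^{∑_{i<k} dg αᵢ} α₁ ⊗ ⋯ ⊗ μ(αₖ,αₖ₊₁) ⊗ ⋯ ⊗ αₙ`.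
The sum runs over the pairs `k = (position, next position)`. -/
def muOne (mul : A →ₗ[K] A →ₗ[K] A) {n : ℕ} (w : Fin n → HomEl 𝒜) : H a 𝒜 :=
  ∑ k ∈ (Finset.univ : Finset (Fin n × Fin n)) with (k.2 : ℕ) = k.1 + 1,
    (degBefore a w k.1).negOnePow • cls a 𝒜 (splice w k.1 2 (muA a mul (w k.1) (w k.2)))

/-- `ℓ₂(X, Y)` for `X = α₁ ⊗ ⋯ ⊗ αₚ` and `Y = αₚ₊₁ ⊗ ⋯ ⊗ αₚ₊q`: the sum over `σ ∈ Bat(p,q)` and over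
the positions `k` with `σ⁻¹(k) ≤ p < σ⁻¹(k+1)` of
`ε(σ⁻¹) (-1)^{(b-a+1) ∑_{s<k} dg α_{σ⁻¹(s)}}
  α_{σ⁻¹(1)} ⊗ ⋯ ⊗ ℓ(α_{σ⁻¹(k)}, α_{σ⁻¹(k+1)}) ⊗ ⋯ ⊗ α_{σ⁻¹(p+q)}`. -/
def ellTwo (b : ℤ) (bra : A →ₗ[K] A →ₗ[K] A) {p q : ℕ}
    (u : Fin p → HomEl 𝒜) (v : Fin q → HomEl 𝒜) : H a 𝒜 :=
  ∑ σ ∈ Bat p q,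
    ∑ k ∈ (Finset.univ : Finset (Fin (p + q) × Fin (p + q))) with
        (k.2 : ℕ) = k.1 + 1 ∧ ((σ⁻¹ k.1 : Fin (p + q)) : ℕ) < p ∧
          p ≤ ((σ⁻¹ k.2 : Fin (p + q)) : ℕ),
      (koszul a (Fin.append u v) σ *
          ((b - a + 1) * degBefore a (permWord σ (Fin.append u v)) k.1).negOnePow) •
        cls a 𝒜 (splice (permWord σ (Fin.append u v)) k.1 2
          (ellA a b bra (permWord σ (Fin.append u v) k.1) (permWord σ (Fin.append u v) k.2)))

end Space

end ABHomotopy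

set_option linter.unusedSimpArgs false
set_option linter.unnecessarySeqFocus false
set_option linter.unusedTactic false
set_option linter.unreachableTactic false

/-! ### Signs as scalars -/

namespace ABHomotopy

variable {K : Type*} [Field K]

/-! In the degree `dg` the product has degree `1`, the bracket has degree `c = b - a + 1`, and the
axioms become those of a `(1, c)`-algebra (`IsDGABAlgebra.shifted`). All identities are then proved
on the full tensor space, before passing to any quotient. That space carries the signed shuffle
product `sh`; `d` and `μ` extend together to a map `diff`, and the bracket extends to a pairing
`lie` of degree `c`. Both are defined by recursion on first letters. In the Koszul rule for `lie`
the bracket symbol stands between its two arguments.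

On tensors, `lie` is graded antisymmetric (`lie_anti`), is a derivation of `sh` in each argument
(`lie_sh`, `sh_lie`) and satisfies Jacobi (`lie_lie`); `diff` has square zero (`diff_diff`) and is a
derivation of `sh` (`diff_sh`) and of `lie` (`diff_lie`). The inductions are on words: terms are
sorted by their first letter. Those that begin with an untouched letter form an induction
hypothesis; the others cancel formally or through an axiom of `A`: graded commutativity for
`diff_sh`, Jacobi for `lie_lie`, Leibniz and the derivation rule of `d` for `diff_lie`.

The derivation properties make the operations descend: `H` is the space of tensors without scalar
part modulo shuffle products of such tensors, and a derivation sends such a product to a sum of such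
products (`exists_diffH`, `exists_lieH`).

It remains to recognise the explicit formulas. Sums over `Bat p q` are rewritten as sums over
interleavings of lists (`sum_Bat`), which obey the same recursions; this gives `bat_eq`,
`dOne_add_muOne` and `ellTwo_eq`. The last one says that `ℓ₂(X, Y)` is `(-1)^{c dg X}` times the
class of `lie`, the sign for moving the bracket symbol from the front to between the arguments.
Since `x' = dg X + c`, the sign in `ℓ'₂` reduces this to the constant `(-1)^c`, and the identities
on tensors, whose signs involve exactly the degrees `m + c`, are those of a differential graded Lie
algebra. -/

variable (K) in
/-- The sign `(-1)ⁿ` as a scalar. -/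
def sg (n : ℤ) : K := ((n.negOnePow : ℤ) : K)

theorem sg_add (m n : ℤ) : sg K (m + n) = sg K m * sg K n := by
  simp [sg, Int.negOnePow_add]

@[simp] theorem sg_zero : sg K 0 = 1 := by simp [sg]

@[simp] theorem sg_one : sg K 1 = -1 := by simp [sg]

theorem sg_neg (m : ℤ) : sg K (-m) = sg K m := by simp [sg]

theorem sg_mul_self (m : ℤ) : sg K m * sg K m = 1 := by
  rw [← sg_add, ← two_mul]; simp [sg]

/-- Exponents of signs are quadratic in the degrees. Once `sg_add` has split them into monomials,
this and the power rules below bring every product of signs to a normal form; the later sign checks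
all work this way. -/
theorem sg_sq (m : ℤ) : sg K (m * m) = sg K m := by
  have h : (m * m).negOnePow = m.negOnePow := by
    rw [Int.negOnePow_eq_iff]
    have := Int.even_mul_pred_self m
    rwa [mul_sub, mul_one] at this
  rw [sg, h, sg]

theorem sg_pow_two (m : ℤ) : sg K m ^ 2 = 1 := by rw [sq, sg_mul_self]

theorem sg_pow_three (m : ℤ) : sg K m ^ 3 = sg K m := by rw [pow_succ, sg_pow_two, one_mul]

theorem sg_pow_four (m : ℤ) : sg K m ^ 4 = 1 := by
  rw [pow_succ, sg_pow_three, sg_mul_self]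

theorem sg_pow_five (m : ℤ) : sg K m ^ 5 = sg K m := by rw [pow_succ, sg_pow_four, one_mul]

theorem negOnePow_smul_eq {N : Type*} [AddCommGroup N] [Module K N] (n : ℤ) (x : N) :
    n.negOnePow • x = sg K n • x := by
  rw [sg, Units.smul_def, Int.cast_smul_eq_zsmul]

/-! ### Words and the signed shuffle product -/

/-- A vector space `T` with a basis of words in a homogeneous basis of `A`. -/
structure WordModel (K A T I : Type*) [Field K] [AddCommGroup A] [Module K A]
    [AddCommGroup T] [Module K T] where
  letter : Module.Basis I K A
  deg : I → ℤ
  word : Module.Basis (List I) K T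
  cons : A →ₗ[K] T →ₗ[K] T
  cons_word : ∀ k l, cons (letter k) (word l) = word (k :: l)

namespace WordModel

variable {A T I : Type*} [AddCommGroup A] [Module K A] [AddCommGroup T] [Module K T]
  (M : WordModel K A T I)

/-- The degree of a word of basis letters. -/
def wdeg (l : List I) : ℤ := (l.map M.deg).sum

@[simp] theorem wdeg_nil : M.wdeg [] = 0 := rfl

@[simp] theorem wdeg_cons (k : I) (l : List I) : M.wdeg (k :: l) = M.deg k + M.wdeg l := by
  simp [wdeg]

/-- The homogeneous components of `A`. -/
def gA (i : ℤ) : Submodule K A := Submodule.span K (M.letter '' {k | M.deg k = i})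

/-- The homogeneous components of the space of words. -/
def gT (m : ℤ) : Submodule K T := Submodule.span K (M.word '' {l | M.wdeg l = m})

theorem letter_mem (k : I) : M.letter k ∈ M.gA (M.deg k) := Submodule.subset_span ⟨k, rfl, rfl⟩

theorem word_mem (l : List I) : M.word l ∈ M.gT (M.wdeg l) := Submodule.subset_span ⟨l, rfl, rfl⟩

theorem one_mem : M.word [] ∈ M.gT 0 := M.word_mem []

theorem cons_mem {i m : ℤ} {x : A} {U : T} (hx : x ∈ M.gA i) (hU : U ∈ M.gT m) :
    M.cons x U ∈ M.gT (i + m) := by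
  induction hx using Submodule.span_induction with
  | zero => simp
  | add x y _ _ h1 h2 => simpa using add_mem h1 h2
  | smul r x _ h => simpa using Submodule.smul_mem _ r h
  | mem x hx =>
    obtain ⟨k, rfl, rfl⟩ := hx
    induction hU using Submodule.span_induction with
    | zero => simp
    | add x y _ _ h1 h2 => simpa using add_mem h1 h2
    | smul r x _ h => simpa using Submodule.smul_mem _ r h
    | mem x hx =>
      obtain ⟨l, rfl, rfl⟩ := hx
      rw [M.cons_word, ← M.wdeg_cons]
      exact M.word_mem _

/-- Induction on homogeneous elements of the space of words. -/
theorem gT_induction {P : ℤ → T → Prop} (zero : ∀ m, P m 0)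
    (add : ∀ m U V, U ∈ M.gT m → V ∈ M.gT m → P m U → P m V → P m (U + V))
    (smul : ∀ m (r : K) U, U ∈ M.gT m → P m U → P m (r • U)) (one : P 0 (M.word []))
    (cons : ∀ i m x U, x ∈ M.gA i → U ∈ M.gT m → P m U → P (i + m) (M.cons x U))
    {m : ℤ} {U : T} (hU : U ∈ M.gT m) : P m U := by
  induction hU using Submodule.span_induction with
  | zero => exact zero m
  | add x y hx hy h1 h2 => exact add m x y hx hy h1 h2
  | smul r x hx h => exact smul m r x hx h
  | mem x hx =>
    obtain ⟨l, rfl, rfl⟩ := hx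
    induction l with
    | nil => exact one
    | cons k l ih =>
      rw [← M.cons_word, wdeg_cons]
      exact cons _ _ _ _ (M.letter_mem k) (M.word_mem l) ih

/-- A linear statement that holds for homogeneous elements holds everywhere. -/
theorem T_induction {P : T → Prop} (zero : P 0) (add : ∀ U V, P U → P V → P (U + V))
    (hom : ∀ m U, U ∈ M.gT m → P U) (U : T) : P U := by
  have h : U ∈ Submodule.span K (Set.range M.word) := by rw [M.word.span_eq]; trivial
  have h' : Submodule.span K (Set.range M.word) ≤ ⨆ m, M.gT m := by
    rw [Submodule.span_le]
    rintro _ ⟨l, rfl⟩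
    exact Submodule.mem_iSup_of_mem _ (M.word_mem l)
  exact Submodule.iSup_induction _ (motive := P) (h' h) hom zero add

/-- The signed shuffle product of two basis words. -/
noncomputable def shWord : List I → List I → T
  | [], v => M.word v
  | i :: u, [] => M.word (i :: u)
  | i :: u, j :: v => M.cons (M.letter i) (shWord u (j :: v)) +
      sg K (M.deg j * (M.deg i + M.wdeg u)) • M.cons (M.letter j) (shWord (i :: u) v)

/-- The signed shuffle product. -/
noncomputable def sh : T →ₗ[K] T →ₗ[K] T :=
  M.word.constr K fun u => M.word.constr K fun v => M.shWord u v

theorem sh_word (u v : List I) : M.sh (M.word u) (M.word v) = M.shWord u v := by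
  simp [sh, Module.Basis.constr_basis]

@[simp] theorem one_sh (V : T) : M.sh (M.word []) V = V := by
  have : M.sh (M.word []) = LinearMap.id := M.word.ext fun v => by simp [sh_word, shWord]
  rw [this]; rfl

@[simp] theorem sh_one (U : T) : M.sh U (M.word []) = U := by
  have : M.sh.flip (M.word []) = LinearMap.id := M.word.ext fun u => by
    cases u <;> simp [sh_word, shWord]
  exact LinearMap.congr_fun this U

/-- The recursion on basis words is linear in each of the four entries once the degrees in the sign
are fixed. The sign is that of moving `y` past `x U`; it does not involve `V`, which therefore need
not be homogeneous. -/
theorem sh_cons_cons {i j m : ℤ} {x y : A} {U V : T} (hx : x ∈ M.gA i) (hU : U ∈ M.gT m)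
    (hy : y ∈ M.gA j) : M.sh (M.cons x U) (M.cons y V) =
      M.cons x (M.sh U (M.cons y V)) + sg K (j * (i + m)) • M.cons y (M.sh (M.cons x U) V) := by
  induction M.word.mem_span V using Submodule.span_induction with
  | zero => simp
  | add x y _ _ h1 h2 => simp only [map_add, smul_add, h1, h2]; abel
  | smul r x _ h => simp only [map_smul, h, smul_add, smul_comm r]
  | mem x hx =>
  obtain ⟨v, rfl⟩ := hx
  induction hx using Submodule.span_induction with
  | zero => simp
  | add x y _ _ h1 h2 => simp only [map_add, LinearMap.add_apply, smul_add, h1, h2]; abel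
  | smul r x _ h => simp only [map_smul, LinearMap.smul_apply, h, smul_add, smul_comm r]
  | mem x hx =>
  obtain ⟨k, rfl, rfl⟩ := hx
  induction hU using Submodule.span_induction with
  | zero => simp
  | add x y _ _ h1 h2 => simp only [map_add, LinearMap.add_apply, smul_add, h1, h2]; abel
  | smul r x _ h => simp only [map_smul, LinearMap.smul_apply, h, smul_add, smul_comm r]
  | mem x hx =>
  obtain ⟨u, rfl, rfl⟩ := hx
  induction hy using Submodule.span_induction with
  | zero => simp
  | add x y _ _ h1 h2 => simp only [map_add, LinearMap.add_apply, smul_add, h1, h2]; abel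
  | smul r x _ h => simp only [map_smul, LinearMap.smul_apply, h, smul_add, smul_comm r]
  | mem x hx =>
  obtain ⟨l, rfl, rfl⟩ := hx
  simp only [cons_word, sh_word, shWord]

theorem sh_mem {m n : ℤ} {U V : T} (hU : U ∈ M.gT m) (hV : V ∈ M.gT n) :
    M.sh U V ∈ M.gT (m + n) := by
  revert n V
  refine M.gT_induction (P := fun m U => ∀ {n V}, V ∈ M.gT n → M.sh U V ∈ M.gT (m + n))
    ?_ ?_ ?_ ?_ ?_ hU
  · simp
  · intro m U V _ _ h1 h2 n W hW
    simpa using add_mem (h1 hW) (h2 hW)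
  · intro m r U _ h n W hW
    simpa using Submodule.smul_mem _ r (h hW)
  · intro n V hV
    simpa using hV
  · intro i m x U hx hU ih n V hV
    refine M.gT_induction (P := fun n V => M.sh (M.cons x U) V ∈ M.gT (i + m + n))
      ?_ ?_ ?_ ?_ ?_ hV
    · simp
    · intro m U V _ _ h1 h2
      simpa using add_mem h1 h2
    · intro m r U _ h
      simpa using Submodule.smul_mem _ r h
    · simpa using M.cons_mem hx hU
    · intro j n y V hy hV ih'
      rw [M.sh_cons_cons hx hU hy]
      refine add_mem ?_ (Submodule.smul_mem _ _ ?_)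
      · rw [add_assoc]
        exact M.cons_mem hx (ih (M.cons_mem hy hV))
      · rw [add_left_comm]
        exact M.cons_mem hy ih'

theorem sh_comm {m n : ℤ} {U V : T} (hU : U ∈ M.gT m) (hV : V ∈ M.gT n) :
    M.sh U V = sg K (m * n) • M.sh V U := by
  revert n V
  refine M.gT_induction (P := fun m U => ∀ {n V}, V ∈ M.gT n → M.sh U V = sg K (m * n) • M.sh V U)
    ?_ ?_ ?_ ?_ ?_ hU
  · simp
  · intro m U V _ _ h1 h2 n W hW
    simp only [map_add, LinearMap.add_apply, h1 hW, h2 hW, smul_add]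
  · intro m r U _ h n W hW
    simp only [map_smul, LinearMap.smul_apply, h hW, smul_comm r]
  · simp
  · intro i m x U hx hU ih n V hV
    refine M.gT_induction (P := fun n V => M.sh (M.cons x U) V =
      sg K ((i + m) * n) • M.sh V (M.cons x U)) ?_ ?_ ?_ ?_ ?_ hV
    · simp
    · intro m U V _ _ h1 h2
      simp only [map_add, LinearMap.add_apply, h1, h2, smul_add]
    · intro m r U _ h
      simp only [map_smul, LinearMap.smul_apply, h, smul_comm r]
    · simp
    · intro j n y V hy hV ih'
      rw [M.sh_cons_cons hx hU hy, M.sh_cons_cons hy hV hx, ih', ih (M.cons_mem hy hV)]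
      simp only [map_smul, smul_add, smul_smul]
      match_scalars <;>
        (try simp only [mul_add, add_mul, sg_add, sg_sq, mul_comm, mul_left_comm]) <;> ring_nf <;>
    try simp only [sg_pow_two, sg_pow_three, sg_pow_four, sg_pow_five, mul_one, one_mul, sub_self,
      neg_add_cancel, add_neg_cancel]

/-- Nested induction on the three words. The first letter of a triple shuffle is `x`, `y` or `z`,
and each case is one of the three induction hypotheses. -/
theorem sh_assoc {m n p : ℤ} {U V W : T} (hU : U ∈ M.gT m) (hV : V ∈ M.gT n) (hW : W ∈ M.gT p) :
    M.sh (M.sh U V) W = M.sh U (M.sh V W) := by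
  revert n p V W
  refine M.gT_induction (P := fun m U => ∀ {n p V W}, V ∈ M.gT n → W ∈ M.gT p →
    M.sh (M.sh U V) W = M.sh U (M.sh V W)) ?_ ?_ ?_ ?_ ?_ hU
  · simp
  · intro m U V _ _ h1 h2 n p V W hV hW
    simp only [map_add, LinearMap.add_apply, h1 hV hW, h2 hV hW]
  · intro m r U _ h n p V W hV hW
    simp only [map_smul, LinearMap.smul_apply, h hV hW]
  · simp
  intro i m x U hx hU ihU n p V W hV hW
  revert p W
  refine M.gT_induction (P := fun n V => ∀ {p W}, W ∈ M.gT p →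
    M.sh (M.sh (M.cons x U) V) W = M.sh (M.cons x U) (M.sh V W)) ?_ ?_ ?_ ?_ ?_ hV
  · simp
  · intro m U V _ _ h1 h2 p W hW
    simp only [map_add, LinearMap.add_apply, h1 hW, h2 hW]
  · intro m r U _ h p W hW
    simp only [map_smul, LinearMap.smul_apply, h hW]
  · simp
  intro j n y V hy hV ihV p W hW
  refine M.gT_induction (P := fun p W =>
    M.sh (M.sh (M.cons x U) (M.cons y V)) W = M.sh (M.cons x U) (M.sh (M.cons y V) W)) 
    ?_ ?_ ?_ ?_ ?_ hW
  · simp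
  · intro m U V _ _ h1 h2
    simp only [map_add, h1, h2]
  · intro m r U _ h
    simp only [map_smul, h]
  · simp
  intro k p z W hz hW ihW
  have hX := M.cons_mem hx hU
  have hY := M.cons_mem hy hV
  have hZ := M.cons_mem hz hW
  have e1 := ihU hY hZ
  have e2 := ihV hZ
  rw [M.sh_cons_cons hx hU hy] at ihW ⊢
  rw [M.sh_cons_cons hy hV hz] at e1 ⊢
  simp only [map_add, map_smul, LinearMap.add_apply, LinearMap.smul_apply] at e1 e2 ihW ⊢
  rw [M.sh_cons_cons hx (M.sh_mem hU hY) hz, M.sh_cons_cons hy (M.sh_mem hX hV) hz,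
    M.sh_cons_cons hx hU hy, M.sh_cons_cons hx hU hz, e1, e2, ← ihW]
  simp only [map_add, map_smul, smul_add, smul_smul]
  match_scalars <;>
        (try simp only [mul_add, add_mul, sg_add, sg_sq, mul_comm, mul_left_comm]) <;> ring_nf <;>
    try simp only [sg_pow_two, sg_pow_three, sg_pow_four, sg_pow_five, mul_one, one_mul, sub_self,
      neg_add_cancel, add_neg_cancel]

end WordModel

/-! ### The bracket on words, a biderivation of the shuffle product -/

namespace IsDGABAlgebra

variable {A : Type*} [AddCommGroup A] [Module K A] {c : ℤ} {𝒜 : ℤ → Submodule K A}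
  {mul bra : A →ₗ[K] A →ₗ[K] A} {d : A →ₗ[K] A}

theorem bra_anti {a : ℤ} (h : IsDGABAlgebra a c 𝒜 mul bra d) {i j : ℤ} {x y : A} (hx : x ∈ 𝒜 i)
    (hy : y ∈ 𝒜 j) : bra x y = -sg K ((i + c) * (j + c)) • bra y x := by
  rw [h.bra_antisymm hx hy, negOnePow_smul_eq (K := K), neg_smul]

/-- The Jacobi identity in Leibniz form. -/
theorem bra_bra {a : ℤ} (h : IsDGABAlgebra a c 𝒜 mul bra d) {i j k : ℤ} {x y z : A}
    (hx : x ∈ 𝒜 i) (hy : y ∈ 𝒜 j) (hz : z ∈ 𝒜 k) :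
    bra x (bra y z) = bra (bra x y) z + sg K ((i + c) * (j + c)) • bra y (bra x z) := by
  have e := h.jacobi hx hy hz
  simp only [negOnePow_smul_eq (K := K)] at e
  rw [h.bra_anti (h.bra_mem hy hz) hx, h.bra_anti (h.bra_mem hz hx) hy, h.bra_anti hz hx] at e
  simp only [map_smul] at e
  have e' := congrArg (fun t => sg K ((i + c) * (k + c)) • t) e
  simp only [smul_add, smul_smul, smul_zero] at e'
  rw [← sub_eq_zero]
  refine Eq.trans ?_ (neg_eq_zero.2 e')
  match_scalars <;>
        (try simp only [mul_add, add_mul, sg_add, sg_sq, mul_comm, mul_left_comm]) <;> ring_nf <;>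
    try simp only [sg_pow_two, sg_pow_three, sg_pow_four, sg_pow_five, mul_one, one_mul, sub_self,
      neg_add_cancel, add_neg_cancel]

end IsDGABAlgebra

namespace WordModel

variable {A T I : Type*} [AddCommGroup A] [Module K A] [AddCommGroup T] [Module K T]
  (M : WordModel K A T I)

/-- The bracket of two basis words. -/
noncomputable def braWord (c : ℤ) (bra : A →ₗ[K] A →ₗ[K] A) : List I → List I → T
  | [], _ => 0
  | _ :: _, [] => 0
  | i :: u, j :: v => M.cons (M.letter i) (braWord c bra u (j :: v)) +
      sg K (M.deg j * (c + (M.deg i + M.wdeg u))) • M.cons (M.letter j) (braWord c bra (i :: u) v) +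
      sg K (M.wdeg u * (M.deg j + c)) • M.cons (bra (M.letter i) (M.letter j)) (M.shWord u v)

/-- The extension of a bracket of degree `c` on `A` to a biderivation of the shuffle product. -/
noncomputable def lie (c : ℤ) (bra : A →ₗ[K] A →ₗ[K] A) : T →ₗ[K] T →ₗ[K] T :=
  M.word.constr K fun u => M.word.constr K fun v => M.braWord c bra u v

variable {c : ℤ} {mul bra : A →ₗ[K] A →ₗ[K] A} {d : A →ₗ[K] A}

theorem lie_word (u v : List I) : M.lie c bra (M.word u) (M.word v) = M.braWord c bra u v := by
  simp [lie, Module.Basis.constr_basis]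

@[simp] theorem one_lie (V : T) : M.lie c bra (M.word []) V = 0 := by
  have : M.lie c bra (M.word []) = 0 := M.word.ext fun v => by simp [lie_word, braWord]
  rw [this]; rfl

@[simp] theorem lie_one (U : T) : M.lie c bra U (M.word []) = 0 := by
  have : (M.lie c bra).flip (M.word []) = 0 := M.word.ext fun u => by
    cases u <;> simp [lie_word, braWord]
  exact LinearMap.congr_fun this U

/-- The signs follow from reading the bracket as a symbol of degree `c` between the two words: `y`
moves past `x U` and the symbol in the second term, and in the third term `y` and the symbol move
past `U`. -/
theorem lie_cons_cons {i j m : ℤ} {x y : A} {U V : T} (hx : x ∈ M.gA i) (hU : U ∈ M.gT m)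
    (hy : y ∈ M.gA j) : M.lie c bra (M.cons x U) (M.cons y V) =
      M.cons x (M.lie c bra U (M.cons y V)) +
      sg K (j * (c + (i + m))) • M.cons y (M.lie c bra (M.cons x U) V) +
      sg K (m * (j + c)) • M.cons (bra x y) (M.sh U V) := by
  induction M.word.mem_span V using Submodule.span_induction with
  | zero => simp
  | add x y _ _ h1 h2 => simp only [map_add, smul_add, h1, h2]; abel
  | smul r x _ h => simp only [map_smul, h, smul_add, smul_comm r]
  | mem x hx =>
  obtain ⟨v, rfl⟩ := hx
  induction hx using Submodule.span_induction with
  | zero => simp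
  | add x y _ _ h1 h2 => simp only [map_add, LinearMap.add_apply, smul_add, h1, h2]; abel
  | smul r x _ h => simp only [map_smul, LinearMap.smul_apply, h, smul_add, smul_comm r]
  | mem x hx =>
  obtain ⟨k, rfl, rfl⟩ := hx
  induction hU using Submodule.span_induction with
  | zero => simp
  | add x y _ _ h1 h2 => simp only [map_add, LinearMap.add_apply, smul_add, h1, h2]; abel
  | smul r x _ h => simp only [map_smul, LinearMap.smul_apply, h, smul_add, smul_comm r]
  | mem x hx =>
  obtain ⟨u, rfl, rfl⟩ := hx
  induction hy using Submodule.span_induction with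
  | zero => simp
  | add x y _ _ h1 h2 => simp only [map_add, LinearMap.add_apply, smul_add, h1, h2]; abel
  | smul r x _ h => simp only [map_smul, LinearMap.smul_apply, h, smul_add, smul_comm r]
  | mem x hx =>
  obtain ⟨l, rfl, rfl⟩ := hx
  simp only [cons_word, lie_word, braWord, sh_word]

theorem lie_mem (h : IsDGABAlgebra 1 c M.gA mul bra d) {m n : ℤ} {U V : T} (hU : U ∈ M.gT m)
    (hV : V ∈ M.gT n) : M.lie c bra U V ∈ M.gT (m + n + c) := by
  revert n V
  refine M.gT_induction (P := fun m U => ∀ {n V}, V ∈ M.gT n → M.lie c bra U V ∈ M.gT (m + n + c))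
    ?_ ?_ ?_ ?_ ?_ hU
  · simp
  · intro m U V _ _ h1 h2 n W hW
    simpa using add_mem (h1 hW) (h2 hW)
  · intro m r U _ h n W hW
    simpa using Submodule.smul_mem _ r (h hW)
  · simp
  · intro i m x U hx hU ih n V hV
    refine M.gT_induction (P := fun n V => M.lie c bra (M.cons x U) V ∈ M.gT (i + m + n + c))
      ?_ ?_ ?_ ?_ ?_ hV
    · simp
    · intro m U V _ _ h1 h2
      simpa using add_mem h1 h2
    · intro m r U _ h
      simpa using Submodule.smul_mem _ r h
    · simp
    · intro j n y V hy hV ih'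
      rw [M.lie_cons_cons hx hU hy]
      refine add_mem (add_mem ?_ (Submodule.smul_mem _ _ ?_)) (Submodule.smul_mem _ _ ?_)
      · convert M.cons_mem hx (ih (M.cons_mem hy hV)) using 2
        ring
      · convert M.cons_mem hy ih' using 2
        ring
      · convert M.cons_mem (h.bra_mem hx hy) (M.sh_mem hU hV) using 2
        ring

theorem lie_anti (h : IsDGABAlgebra 1 c M.gA mul bra d) {m n : ℤ} {U V : T} (hU : U ∈ M.gT m)
    (hV : V ∈ M.gT n) : M.lie c bra U V = -sg K ((m + c) * (n + c)) • M.lie c bra V U := by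
  revert n V
  refine M.gT_induction (P := fun m U => ∀ {n V}, V ∈ M.gT n →
    M.lie c bra U V = -sg K ((m + c) * (n + c)) • M.lie c bra V U) ?_ ?_ ?_ ?_ ?_ hU
  · simp
  · intro m U V _ _ h1 h2 n W hW
    simp only [map_add, LinearMap.add_apply, h1 hW, h2 hW, smul_add]
  · intro m r U _ h n W hW
    simp only [map_smul, LinearMap.smul_apply, h hW, smul_comm r]
  · simp
  · intro i m x U hx hU ih n V hV
    refine M.gT_induction (P := fun n V => M.lie c bra (M.cons x U) V =
      -sg K ((i + m + c) * (n + c)) • M.lie c bra V (M.cons x U)) ?_ ?_ ?_ ?_ ?_ hV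
    · simp
    · intro m U V _ _ h1 h2
      simp only [map_add, LinearMap.add_apply, h1, h2, smul_add]
    · intro m r U _ h
      simp only [map_smul, LinearMap.smul_apply, h, smul_comm r]
    · simp
    · intro j n y V hy hV ih'
      rw [M.lie_cons_cons hx hU hy, M.lie_cons_cons hy hV hx, ih', ih (M.cons_mem hy hV),
        M.sh_comm hU hV, h.bra_anti hx hy]
      simp only [map_smul, LinearMap.smul_apply, smul_add, smul_smul]
      match_scalars <;>
        (try simp only [mul_add, add_mul, sg_add, sg_sq, mul_comm, mul_left_comm]) <;> ring_nf <;>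
    try simp only [sg_pow_two, sg_pow_three, sg_pow_four, sg_pow_five, mul_one, one_mul, sub_self,
      neg_add_cancel, add_neg_cancel]

theorem sh_left_comm {m n p : ℤ} {U V W : T} (hU : U ∈ M.gT m) (hV : V ∈ M.gT n)
    (hW : W ∈ M.gT p) : M.sh V (M.sh U W) = sg K (n * m) • M.sh U (M.sh V W) := by
  rw [← M.sh_assoc hV hU hW, M.sh_comm hV hU, map_smul, LinearMap.smul_apply, M.sh_assoc hU hV hW]

/-- Every term begins with `x`, `y`, `z`, `[x, y]` or `[x, z]`. The first three families are the
induction hypotheses; the last two agree by associativity and commutativity of `sh`, with no use of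
Jacobi or Leibniz in `A`. -/
theorem lie_sh (h : IsDGABAlgebra 1 c M.gA mul bra d) {m n p : ℤ} {U V W : T} (hU : U ∈ M.gT m)
    (hV : V ∈ M.gT n) (hW : W ∈ M.gT p) : M.lie c bra U (M.sh V W) =
      M.sh (M.lie c bra U V) W + sg K (n * (m + c)) • M.sh V (M.lie c bra U W) := by
  revert n p V W
  refine M.gT_induction (P := fun m U => ∀ {n p V W}, V ∈ M.gT n → W ∈ M.gT p →
    M.lie c bra U (M.sh V W) = M.sh (M.lie c bra U V) W +
      sg K (n * (m + c)) • M.sh V (M.lie c bra U W)) ?_ ?_ ?_ ?_ ?_ hU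
  · simp
  · intro m U V _ _ h1 h2 n p V W hV hW
    simp only [map_add, LinearMap.add_apply, h1 hV hW, h2 hV hW, smul_add]
    abel
  · intro m r U _ h n p V W hV hW
    simp only [map_smul, LinearMap.smul_apply, h hV hW, smul_add, smul_comm r]
  · simp
  intro i m x U hx hU ihU n p V W hV hW
  revert p W
  refine M.gT_induction (P := fun n V => ∀ {p W}, W ∈ M.gT p →
    M.lie c bra (M.cons x U) (M.sh V W) = M.sh (M.lie c bra (M.cons x U) V) W +
      sg K (n * (i + m + c)) • M.sh V (M.lie c bra (M.cons x U) W)) ?_ ?_ ?_ ?_ ?_ hV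
  · simp
  · intro m U V _ _ h1 h2 p W hW
    simp only [map_add, LinearMap.add_apply, h1 hW, h2 hW, smul_add]
    abel
  · intro m r U _ h p W hW
    simp only [map_smul, LinearMap.smul_apply, h hW, smul_add, smul_comm r]
  · simp
  intro j n y V hy hV ihV p W hW
  refine M.gT_induction (P := fun p W => M.lie c bra (M.cons x U) (M.sh (M.cons y V) W) =
      M.sh (M.lie c bra (M.cons x U) (M.cons y V)) W + sg K ((j + n) * (i + m + c)) •
        M.sh (M.cons y V) (M.lie c bra (M.cons x U) W)) ?_ ?_ ?_ ?_ ?_ hW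
  · simp
  · intro m U V _ _ h1 h2
    simp only [map_add, h1, h2, smul_add]
    abel
  · intro m r U _ h
    simp only [map_smul, h, smul_add, smul_comm r]
  · simp
  intro k p z W hz hW ihW
  have hX := M.cons_mem hx hU
  have hY := M.cons_mem hy hV
  have hZ := M.cons_mem hz hW
  -- The three induction hypotheses, prefixed by the letter that begins the terms they compare.
  have e1 := congrArg (M.cons x) (ihU hY hZ)
  have e2 := congrArg (M.cons y) (ihV hZ)
  have e3 := congrArg (M.cons z) ihW
  rw [M.sh_cons_cons hy hV hz] at e1
  rw [M.lie_cons_cons hx hU hz] at e2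
  rw [M.lie_cons_cons hx hU hy] at e3
  rw [M.sh_cons_cons hy hV hz, map_add, map_smul, M.lie_cons_cons hx hU hy,
    M.lie_cons_cons hx hU hz, M.lie_cons_cons hx hU hy, M.lie_cons_cons hx hU hz]
  simp only [map_add, map_smul, LinearMap.add_apply, LinearMap.smul_apply] at e1 e2 e3 ⊢
  rw [M.sh_cons_cons hx (M.lie_mem h hU hY) hz, M.sh_cons_cons hy (M.lie_mem h hX hV) hz,
    M.sh_cons_cons (h.bra_mem hx hy) (M.sh_mem hU hV) hz, M.sh_cons_cons hy hV hx,
    M.sh_cons_cons hy hV hz, M.sh_cons_cons hy hV (h.bra_mem hx hz), M.sh_assoc hU hV hZ,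
    M.sh_left_comm hU hY hW]
  simp only [map_add, map_smul, LinearMap.add_apply, LinearMap.smul_apply]
  linear_combination (norm := skip) e1 + sg K (j * (c + (i + m))) • e2 +
    (sg K (k * (j + n)) * sg K (k * (c + (i + m)))) • e3
  match_scalars <;>
        (try simp only [mul_add, add_mul, sg_add, sg_sq, mul_comm, mul_left_comm]) <;> ring_nf <;>
    try simp only [sg_pow_two, sg_pow_three, sg_pow_four, sg_pow_five, mul_one, one_mul, sub_self,
      neg_add_cancel, add_neg_cancel]

end WordModel

/-! ### The Jacobi identity on words -/

namespace WordModel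

variable {A T I : Type*} [AddCommGroup A] [Module K A] [AddCommGroup T] [Module K T]
  (M : WordModel K A T I)

variable {c : ℤ} {mul bra : A →ₗ[K] A →ₗ[K] A} {d : A →ₗ[K] A}

theorem sh_lie (h : IsDGABAlgebra 1 c M.gA mul bra d) {m n p : ℤ} {U V W : T} (hU : U ∈ M.gT m)
    (hV : V ∈ M.gT n) (hW : W ∈ M.gT p) : M.lie c bra (M.sh U V) W =
      M.sh U (M.lie c bra V W) + sg K (n * (p + c)) • M.sh (M.lie c bra U W) V := by
  rw [M.lie_anti h (M.sh_mem hU hV) hW, M.lie_sh h hW hU hV, M.lie_anti h hW hU,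
    M.lie_anti h hW hV]
  simp only [map_smul, LinearMap.smul_apply]
  match_scalars <;>
    (try simp only [mul_add, add_mul, sg_add, sg_sq, mul_comm, mul_left_comm]) <;> ring_nf <;>
    try simp only [sg_pow_two, sg_pow_three, sg_pow_four, sg_pow_five, mul_one, one_mul, sub_self,
      neg_add_cancel, add_neg_cancel]

-- Terms that begin with a single letter are handled by induction. A term that begins with a bracket
-- of two letters has a tail in which the bracket meets a shuffle product, so `lie_sh` and `sh_lie`
-- expand it. Nested brackets of `x`, `y`, `z` cancel by Jacobi in `A`, all with the triple shuffle
-- of `U`, `V`, `W` as tail.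
set_option maxHeartbeats 2000000 in
theorem lie_lie (h : IsDGABAlgebra 1 c M.gA mul bra d) {m n p : ℤ} {U V W : T} (hU : U ∈ M.gT m)
    (hV : V ∈ M.gT n) (hW : W ∈ M.gT p) : M.lie c bra U (M.lie c bra V W) =
      M.lie c bra (M.lie c bra U V) W +
        sg K ((m + c) * (n + c)) • M.lie c bra V (M.lie c bra U W) := by
  revert n p V W
  refine M.gT_induction (P := fun m U => ∀ {n p V W}, V ∈ M.gT n → W ∈ M.gT p →
    M.lie c bra U (M.lie c bra V W) = M.lie c bra (M.lie c bra U V) W +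
        sg K ((m + c) * (n + c)) • M.lie c bra V (M.lie c bra U W)) ?_ ?_ ?_ ?_ ?_ hU
  · simp
  · intro m U V _ _ h1 h2 n p V W hV hW
    simp only [map_add, LinearMap.add_apply, h1 hV hW, h2 hV hW, smul_add]
    abel
  · intro m r U _ h n p V W hV hW
    simp only [map_smul, LinearMap.smul_apply, h hV hW, smul_add, smul_comm r]
  · simp
  intro i m x U hx hU ihU n p V W hV hW
  revert p W
  refine M.gT_induction (P := fun n V => ∀ {p W}, W ∈ M.gT p →
    M.lie c bra (M.cons x U) (M.lie c bra V W) = M.lie c bra (M.lie c bra (M.cons x U) V) W +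
      sg K ((i + m + c) * (n + c)) • M.lie c bra V (M.lie c bra (M.cons x U) W)) ?_ ?_ ?_ ?_ ?_ hV
  · simp
  · intro m U V _ _ h1 h2 p W hW
    simp only [map_add, LinearMap.add_apply, h1 hW, h2 hW, smul_add]
    abel
  · intro m r U _ h p W hW
    simp only [map_smul, LinearMap.smul_apply, h hW, smul_add, smul_comm r]
  · simp
  intro j n y V hy hV ihV p W hW
  refine M.gT_induction (P := fun p W => M.lie c bra (M.cons x U) (M.lie c bra (M.cons y V) W) =
      M.lie c bra (M.lie c bra (M.cons x U) (M.cons y V)) W + sg K ((i + m + c) * (j + n + c)) •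
        M.lie c bra (M.cons y V) (M.lie c bra (M.cons x U) W)) ?_ ?_ ?_ ?_ ?_ hW
  · simp
  · intro m U V _ _ h1 h2
    simp only [map_add, h1, h2, smul_add]
    abel
  · intro m r U _ h
    simp only [map_smul, h, smul_add, smul_comm r]
  · simp
  intro k p z W hz hW ihW
  have hX := M.cons_mem hx hU
  have hY := M.cons_mem hy hV
  have hZ := M.cons_mem hz hW
  have e1 := congrArg (M.cons x) (ihU hY hZ)
  have e2 := congrArg (M.cons y) (ihV hZ)
  have e3 := congrArg (M.cons z) ihW
  rw [M.lie_cons_cons hy hV hz] at e1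
  rw [M.lie_cons_cons hx hU hz] at e2
  rw [M.lie_cons_cons hx hU hy] at e3
  rw [M.lie_cons_cons hx hU hy, M.lie_cons_cons hy hV hz, M.lie_cons_cons hx hU hz]
  simp only [map_add, map_smul, LinearMap.add_apply, LinearMap.smul_apply] at e1 e2 e3 ⊢
  rw [M.lie_cons_cons hx hU hy, M.lie_cons_cons hx hU hz, M.lie_cons_cons hx hU (h.bra_mem hy hz),
    M.lie_cons_cons hx (M.lie_mem h hU hY) hz, M.lie_cons_cons hy (M.lie_mem h hX hV) hz,
    M.lie_cons_cons (h.bra_mem hx hy) (M.sh_mem hU hV) hz,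
    M.lie_cons_cons hy hV hx, M.lie_cons_cons hy hV hz, M.lie_cons_cons hy hV (h.bra_mem hx hz),
    M.lie_sh h hX hV hW, M.sh_lie h hU hV hZ, M.lie_sh h hY hU hW, M.lie_anti h hY hU,
    M.sh_comm hV (M.lie_mem h hU hZ), M.sh_assoc hU hV hW, M.sh_left_comm hU hV hW,
    h.bra_bra hx hy hz, h.bra_anti hy hx]
  simp only [map_add, map_smul, LinearMap.add_apply, LinearMap.smul_apply]
  linear_combination (norm := skip) e1 + sg K (j * (c + (i + m))) • e2 +
    (sg K (k * (c + (j + n))) * sg K (k * (c + (i + m)))) • e3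
  match_scalars <;>
    (try simp only [mul_add, add_mul, sg_add, sg_sq, mul_comm, mul_left_comm]) <;> ring_nf <;>
    try simp only [sg_pow_two, sg_pow_three, sg_pow_four, sg_pow_five, mul_one, one_mul, sub_self,
      neg_add_cancel, add_neg_cancel]

end WordModel

/-! ### The differential on words -/

namespace IsDGABAlgebra

variable {A : Type*} [AddCommGroup A] [Module K A] {c : ℤ} {𝒜 : ℤ → Submodule K A}
  {mul bra : A →ₗ[K] A →ₗ[K] A} {d : A →ₗ[K] A}

theorem bra_mul {a : ℤ} (h : IsDGABAlgebra a c 𝒜 mul bra d) {i j k : ℤ} {x y z : A}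
    (hx : x ∈ 𝒜 i) (hy : y ∈ 𝒜 j) (hz : z ∈ 𝒜 k) :
    bra (mul x y) z = mul x (bra y z) + sg K ((j + a) * (k + c)) • mul (bra x z) y := by
  rw [h.bra_anti (h.mul_mem hx hy) hz, h.leibniz hz hx hy, h.bra_anti hz hx, h.bra_anti hz hy,
    negOnePow_smul_eq (K := K)]
  simp only [map_smul, LinearMap.smul_apply]
  match_scalars <;>
    (try simp only [mul_add, add_mul, sg_add, sg_sq, mul_comm, mul_left_comm]) <;> ring_nf <;>
    try simp only [sg_pow_two, sg_pow_three, sg_pow_four, sg_pow_five, mul_one, one_mul, sub_self,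
      neg_add_cancel, add_neg_cancel]

end IsDGABAlgebra
namespace WordModel

variable {A T I : Type*} [AddCommGroup A] [Module K A] [AddCommGroup T] [Module K T]
  (M : WordModel K A T I)

/-- `absorb mul (x U) z V = (z · x) (U ⧢ V)`, and `0` if the first word is empty. -/
noncomputable def absorb (mul : A →ₗ[K] A →ₗ[K] A) : T →ₗ[K] A →ₗ[K] T →ₗ[K] T :=
  M.word.constr K fun u => match u with
    | [] => 0
    | k :: u => M.cons.compl₁₂ (mul.flip (M.letter k)) (M.sh (M.word u))

/-- The differential of a basis word. -/
noncomputable def diffWord (mul : A →ₗ[K] A →ₗ[K] A) (d : A →ₗ[K] A) : List I → T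
  | [] => 0
  | k :: u => M.cons (d (M.letter k)) (M.word u) + sg K (M.deg k) •
      (M.cons (M.letter k) (diffWord mul d u) + M.absorb mul (M.word u) (M.letter k) (M.word []))

/-- The coderivation extending the differential and the product of `A`. -/
noncomputable def diff (mul : A →ₗ[K] A →ₗ[K] A) (d : A →ₗ[K] A) : T →ₗ[K] T :=
  M.word.constr K (M.diffWord mul d)

variable {c : ℤ} {mul bra : A →ₗ[K] A →ₗ[K] A} {d : A →ₗ[K] A}

@[simp] theorem absorb_one (z : A) (V : T) : M.absorb mul (M.word []) z V = 0 := by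
  simp [absorb, Module.Basis.constr_basis]

@[simp] theorem absorb_cons (x z : A) (U V : T) :
    M.absorb mul (M.cons x U) z V = M.cons (mul z x) (M.sh U V) := by
  induction M.word.mem_span U using Submodule.span_induction with
  | zero => simp
  | add x y _ _ h1 h2 => simp only [map_add, LinearMap.add_apply, h1, h2]
  | smul r x _ h => simp only [map_smul, LinearMap.smul_apply, h]
  | mem U hU =>
  obtain ⟨u, rfl⟩ := hU
  induction M.letter.mem_span x using Submodule.span_induction with
  | zero => simp
  | add x y _ _ h1 h2 => simp only [map_add, LinearMap.add_apply, h1, h2]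
  | smul r x _ h => simp only [map_smul, LinearMap.smul_apply, h]
  | mem x hx =>
  obtain ⟨k, rfl⟩ := hx
  simp [cons_word, absorb, Module.Basis.constr_basis]

theorem absorb_mem (h : IsDGABAlgebra 1 c M.gA mul bra d) {i m n : ℤ} {z : A} {U V : T}
    (hU : U ∈ M.gT m) (hz : z ∈ M.gA i) (hV : V ∈ M.gT n) :
    M.absorb mul U z V ∈ M.gT (i + m + n + 1) := by
  refine M.gT_induction (P := fun m U => M.absorb mul U z V ∈ M.gT (i + m + n + 1))
    ?_ ?_ ?_ ?_ ?_ hU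
  · simp
  · intro m U V _ _ h1 h2
    simpa using add_mem h1 h2
  · intro m r U _ h
    simpa using Submodule.smul_mem _ r h
  · simp
  · intro j m x U hx hU _
    rw [absorb_cons]
    convert M.cons_mem (h.mul_mem hz hx) (M.sh_mem hU hV) using 2
    ring

theorem absorb_mem_one (h : IsDGABAlgebra 1 c M.gA mul bra d) {i m : ℤ} {z : A} {U : T}
    (hU : U ∈ M.gT m) (hz : z ∈ M.gA i) : M.absorb mul U z (M.word []) ∈ M.gT (i + m + 1) := by
  simpa using M.absorb_mem h hU hz M.one_mem

@[simp] theorem diff_one : M.diff mul d (M.word []) = 0 := by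
  simp [diff, Module.Basis.constr_basis, diffWord]

theorem diff_cons {i : ℤ} {x : A} (hx : x ∈ M.gA i) (U : T) :
    M.diff mul d (M.cons x U) = M.cons (d x) U +
      sg K i • (M.cons x (M.diff mul d U) + M.absorb mul U x (M.word [])) := by
  induction M.word.mem_span U using Submodule.span_induction with
  | zero => simp
  | add x y _ _ h1 h2 => simp only [map_add, LinearMap.add_apply, smul_add, h1, h2]; abel
  | smul r x _ h => simp only [map_smul, LinearMap.smul_apply, h, smul_add, smul_comm r]
  | mem U hU =>
  obtain ⟨u, rfl⟩ := hU
  induction hx using Submodule.span_induction with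
  | zero => simp
  | add x y _ _ h1 h2 => simp only [map_add, LinearMap.add_apply, smul_add, h1, h2]; abel
  | smul r x _ h => simp only [map_smul, LinearMap.smul_apply, h, smul_add, smul_comm r]
  | mem x hx =>
  obtain ⟨k, rfl, rfl⟩ := hx
  simp only [cons_word, diff, Module.Basis.constr_basis, diffWord]

theorem diff_mem (h : IsDGABAlgebra 1 c M.gA mul bra d) {m : ℤ} {U : T} (hU : U ∈ M.gT m) :
    M.diff mul d U ∈ M.gT (m + 1) := by
  refine M.gT_induction (P := fun m U => M.diff mul d U ∈ M.gT (m + 1)) ?_ ?_ ?_ ?_ ?_ hU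
  · simp
  · intro m U V _ _ h1 h2
    simpa using add_mem h1 h2
  · intro m r U _ h
    simpa using Submodule.smul_mem _ r h
  · simp
  · intro i m x U hx hU ih
    rw [M.diff_cons hx]
    refine add_mem ?_ (Submodule.smul_mem _ _ (add_mem ?_ (M.absorb_mem_one h hU hx)))
    · convert M.cons_mem (h.d_mem hx) hU using 2
      ring
    · rw [add_assoc]
      exact M.cons_mem hx ih

theorem absorb_absorb (h : IsDGABAlgebra 1 c M.gA mul bra d) (x y : A) {m : ℤ} {U : T}
    (hU : U ∈ M.gT m) : M.absorb mul (M.absorb mul U y (M.word [])) x (M.word []) =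
      M.absorb mul U (mul x y) (M.word []) := by
  refine M.gT_induction (P := fun m U => M.absorb mul (M.absorb mul U y (M.word [])) x (M.word []) =
      M.absorb mul U (mul x y) (M.word [])) ?_ ?_ ?_ ?_ ?_ hU
  · simp
  · intro m U V _ _ h1 h2
    simp only [map_add, LinearMap.add_apply, h1, h2]
  · intro m r U _ h
    simp only [map_smul, LinearMap.smul_apply, h]
  · simp
  · intro i m z U _ _ _
    simp [h.mul_assoc]

/-- This combines the derivation rule of `d` with associativity; the minus sign appears because the
product is odd in the shifted grading. It is what makes the cross terms of `diff_diff` cancel. -/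
theorem diff_absorb (h : IsDGABAlgebra 1 c M.gA mul bra d) {i m : ℤ} {x : A} {U : T}
    (hx : x ∈ M.gA i) (hU : U ∈ M.gT m) : M.diff mul d (M.absorb mul U x (M.word [])) =
      M.absorb mul U (d x) (M.word []) -
        sg K i • M.absorb mul (M.diff mul d U) x (M.word []) := by
  refine M.gT_induction (P := fun m U => M.diff mul d (M.absorb mul U x (M.word [])) =
      M.absorb mul U (d x) (M.word []) -
        sg K i • M.absorb mul (M.diff mul d U) x (M.word [])) ?_ ?_ ?_ ?_ ?_ hU
  · simp
  · intro m U V _ _ h1 h2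
    simp only [map_add, LinearMap.add_apply, h1, h2, smul_add]
    abel
  · intro m r U _ h
    simp only [map_smul, LinearMap.smul_apply, h, smul_sub, smul_comm r]
  · simp
  · intro j m y U hy hU _
    rw [absorb_cons, absorb_cons, sh_one, M.diff_cons (h.mul_mem hx hy), M.diff_cons hy,
      h.d_mul hx hy, negOnePow_smul_eq (K := K)]
    simp only [map_add, map_smul, LinearMap.add_apply, LinearMap.smul_apply, absorb_cons, sh_one,
      M.absorb_absorb h x y hU, smul_add, smul_smul, sg_add, sg_one]
    module

theorem diff_diff (h : IsDGABAlgebra 1 c M.gA mul bra d) (U : T) :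
    M.diff mul d (M.diff mul d U) = 0 := by
  refine M.T_induction (P := fun U => M.diff mul d (M.diff mul d U) = 0) (by simp) ?_ ?_ U
  · intro U V h1 h2
    simp only [map_add, h1, h2, add_zero]
  intro m U hU
  refine M.gT_induction (P := fun m U => M.diff mul d (M.diff mul d U) = 0) ?_ ?_ ?_ ?_ ?_ hU
  · simp
  · intro m U V _ _ h1 h2
    simp only [map_add, h1, h2, add_zero]
  · intro m r U _ h
    simp only [map_smul, h, smul_zero]
  · simp
  · intro i m x U hx hU ih
    simp only [M.diff_cons hx, map_add, map_smul, M.diff_cons (h.d_mem hx), M.diff_absorb h hx hU,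
      h.d_d, map_zero, LinearMap.zero_apply, zero_add, ih, sg_add, sg_one]
    module

/-- The letter that `z` meets is the first one of a shuffle, hence the first letter of `U` or of
`V`. -/
theorem absorb_sh {m n : ℤ} (z : A) {U V : T} (hU : U ∈ M.gT m) (hV : V ∈ M.gT n) :
    M.absorb mul (M.sh U V) z (M.word []) =
      M.absorb mul U z V + sg K (m * n) • M.absorb mul V z U := by
  refine M.gT_induction (P := fun m U => M.absorb mul (M.sh U V) z (M.word []) =
      M.absorb mul U z V + sg K (m * n) • M.absorb mul V z U) ?_ ?_ ?_ ?_ ?_ hU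
  · simp
  · intro m U V _ _ h1 h2
    simp only [map_add, LinearMap.add_apply, h1, h2, smul_add]
    abel
  · intro m r U _ h
    simp only [map_smul, LinearMap.smul_apply, h, smul_add, smul_comm r]
  · simp
  intro i m x U hx hU _
  refine M.gT_induction (P := fun n V => M.absorb mul (M.sh (M.cons x U) V) z (M.word []) =
      M.absorb mul (M.cons x U) z V + sg K ((i + m) * n) • M.absorb mul V z (M.cons x U))
    ?_ ?_ ?_ ?_ ?_ hV
  · simp
  · intro m U V _ _ h1 h2
    simp only [map_add, LinearMap.add_apply, h1, h2, smul_add]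
    abel
  · intro m r U _ h
    simp only [map_smul, LinearMap.smul_apply, h, smul_add, smul_comm r]
  · simp
  intro j n y V hy hV _
  rw [M.sh_cons_cons hx hU hy]
  simp only [map_add, map_smul, LinearMap.add_apply, LinearMap.smul_apply, absorb_cons, sh_one]
  rw [M.sh_comm (M.cons_mem hx hU) hV, map_smul]
  match_scalars <;>
    (try simp only [mul_add, add_mul, sg_add, sg_sq, mul_comm, mul_left_comm]) <;> ring_nf <;>
    try simp only [sg_pow_two, sg_pow_three, sg_pow_four, sg_pow_five, mul_one, one_mul, sub_self,
      neg_add_cancel, add_neg_cancel]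

/-- Shuffles that begin with the merged letter are all shuffles minus those that begin with `y`. In
this form `U` need not be split into a first letter and a tail when it is used. -/
theorem absorb_cons_right (h : IsDGABAlgebra 1 c M.gA mul bra d) {i j m : ℤ} {y z : A} {U V : T}
    (hU : U ∈ M.gT m) (hz : z ∈ M.gA i) (hy : y ∈ M.gA j) :
    M.absorb mul U z (M.cons y V) = M.sh (M.absorb mul U z (M.word [])) (M.cons y V) -
      sg K (j * (i + m + 1)) • M.cons y (M.sh (M.absorb mul U z (M.word [])) V) := by
  refine M.gT_induction (P := fun m U => M.absorb mul U z (M.cons y V) =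
      M.sh (M.absorb mul U z (M.word [])) (M.cons y V) -
      sg K (j * (i + m + 1)) • M.cons y (M.sh (M.absorb mul U z (M.word [])) V))
    ?_ ?_ ?_ ?_ ?_ hU
  · simp
  · intro m U V _ _ h1 h2
    simp only [map_add, LinearMap.add_apply, h1, h2, smul_add]
    abel
  · intro m r U _ h
    simp only [map_smul, LinearMap.smul_apply, h, smul_sub, smul_comm r]
  · simp
  intro k m x U hx hU _
  simp only [absorb_cons, sh_one]
  rw [M.sh_cons_cons (h.mul_mem hz hx) hU hy,
    show i + k + 1 + m = i + (k + m) + 1 by ring, add_sub_cancel_right]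

/-- Merging neighbours that come from different words must contribute nothing. The letters `x` and
`y` occur as neighbours in both orders, and the two products cancel because `μ` is graded
antisymmetric for `dg`, by `mul_comm`. -/
theorem diff_sh (h : IsDGABAlgebra 1 c M.gA mul bra d) {m n : ℤ} {U V : T} (hU : U ∈ M.gT m)
    (hV : V ∈ M.gT n) : M.diff mul d (M.sh U V) =
      M.sh (M.diff mul d U) V + sg K m • M.sh U (M.diff mul d V) := by
  revert n V
  refine M.gT_induction (P := fun m U => ∀ {n V}, V ∈ M.gT n → M.diff mul d (M.sh U V) =
      M.sh (M.diff mul d U) V + sg K m • M.sh U (M.diff mul d V)) ?_ ?_ ?_ ?_ ?_ hU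
  · simp
  · intro m U V _ _ h1 h2 n W hW
    simp only [map_add, LinearMap.add_apply, h1 hW, h2 hW, smul_add]
    abel
  · intro m r U _ h n W hW
    simp only [map_smul, LinearMap.smul_apply, h hW, smul_add, smul_comm r]
  · simp
  intro i m x U hx hU ihU n V hV
  refine M.gT_induction (P := fun n V => M.diff mul d (M.sh (M.cons x U) V) =
      M.sh (M.diff mul d (M.cons x U)) V + sg K (i + m) • M.sh (M.cons x U) (M.diff mul d V))
    ?_ ?_ ?_ ?_ ?_ hV
  · simp
  · intro m U V _ _ h1 h2
    simp only [map_add, h1, h2, smul_add]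
    abel
  · intro m r U _ h
    simp only [map_smul, h, smul_add, smul_comm r]
  · simp
  intro j n y V hy hV ihV
  have hX := M.cons_mem hx hU
  have hY := M.cons_mem hy hV
  have e1 := congrArg (M.cons x) (ihU hY)
  have e2 := congrArg (M.cons y) ihV
  rw [M.diff_cons hy] at e1
  rw [M.diff_cons hx] at e2
  have hUx := M.absorb_mem_one h hU hx
  have hVy := M.absorb_mem_one h hV hy
  rw [M.sh_cons_cons hx hU hy, map_add, map_smul, M.diff_cons hx, M.diff_cons hy, M.diff_cons hx,
    M.diff_cons hy, M.absorb_sh x hU hY, M.absorb_sh y hX hV, M.absorb_cons_right h hU hx hy,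
    M.absorb_cons_right h hV hy hx, M.sh_comm hVy hX, M.sh_comm hVy hU]
  simp only [map_add, map_smul, LinearMap.add_apply, LinearMap.smul_apply, absorb_cons] at e1 e2 ⊢
  rw [M.sh_cons_cons (h.d_mem hx) hU hy, M.sh_cons_cons hx (M.diff_mem h hU) hy,
    M.sh_cons_cons hx hU (h.d_mem hy), M.sh_cons_cons hx hU hy, M.sh_comm hV hU,
    h.mul_comm hy hx, negOnePow_smul_eq (K := K)]
  simp only [map_add, map_smul, LinearMap.add_apply, LinearMap.smul_apply]
  linear_combination (norm := skip) sg K i • e1 + (sg K (j * (i + m)) * sg K j) • e2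
  match_scalars <;>
    (try simp only [mul_add, add_mul, sg_add, sg_sq, mul_comm, mul_left_comm, sg_one, mul_one,
      one_mul]) <;> ring_nf <;>
    try simp only [sg_pow_two, sg_pow_three, sg_pow_four, sg_pow_five, mul_one, one_mul, sub_self,
      neg_add_cancel, add_neg_cancel]

/-- Here `x` is multiplied into a first letter of the bracket, which is the first letter `z` of `U`,
or `y`, or `[z, y]`. In the last case Leibniz compares `x · [z, y]` with `[x · z, y]`, and the error
`[x, y] · z` is the final term. -/
theorem absorb_lie (h : IsDGABAlgebra 1 c M.gA mul bra d) {i j m : ℤ} {x y : A} {U V : T}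
    (hU : U ∈ M.gT m) (hx : x ∈ M.gA i) (hy : y ∈ M.gA j) :
    M.absorb mul (M.lie c bra U (M.cons y V)) x (M.word []) =
      M.lie c bra (M.absorb mul U x (M.word [])) (M.cons y V) -
      sg K (j * (c + (i + m + 1))) • M.cons y (M.lie c bra (M.absorb mul U x (M.word [])) V) +
      sg K (j * (c + m)) • M.cons (mul x y) (M.lie c bra U V) -
      sg K ((m + 1) * (j + c)) • M.absorb mul U (bra x y) V := by
  refine M.gT_induction (P := fun m U => M.absorb mul (M.lie c bra U (M.cons y V)) x (M.word []) =
      M.lie c bra (M.absorb mul U x (M.word [])) (M.cons y V) -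
      sg K (j * (c + (i + m + 1))) • M.cons y (M.lie c bra (M.absorb mul U x (M.word [])) V) +
      sg K (j * (c + m)) • M.cons (mul x y) (M.lie c bra U V) -
      sg K ((m + 1) * (j + c)) • M.absorb mul U (bra x y) V) ?_ ?_ ?_ ?_ ?_ hU
  · simp
  · intro m U V _ _ h1 h2
    simp only [map_add, LinearMap.add_apply, h1, h2, smul_add]
    abel
  · intro m r U _ h
    simp only [map_smul, LinearMap.smul_apply, h, smul_sub, smul_add, smul_comm r]
  · simp
  intro k m z U hz hU _
  rw [M.lie_cons_cons hz hU hy]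
  simp only [map_add, map_smul, LinearMap.add_apply, LinearMap.smul_apply, absorb_cons, sh_one]
  rw [M.lie_cons_cons (h.mul_mem hx hz) hU hy, h.bra_mul hx hz hy]
  simp only [map_add, map_smul, LinearMap.add_apply, LinearMap.smul_apply]
  match_scalars <;>
    (try simp only [mul_add, add_mul, sg_add, sg_sq, mul_comm, mul_left_comm, sg_one, mul_one,
      one_mul]) <;> ring_nf <;>
    try simp only [sg_pow_two, sg_pow_three, sg_pow_four, sg_pow_five, mul_one, one_mul, sub_self,
      neg_add_cancel, add_neg_cancel]

set_option maxHeartbeats 2000000 in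
theorem diff_lie (h : IsDGABAlgebra 1 c M.gA mul bra d) {m n : ℤ} {U V : T} (hU : U ∈ M.gT m)
    (hV : V ∈ M.gT n) : M.diff mul d (M.lie c bra U V) =
      M.lie c bra (M.diff mul d U) V + sg K (m + c) • M.lie c bra U (M.diff mul d V) := by
  revert n V
  refine M.gT_induction (P := fun m U => ∀ {n V}, V ∈ M.gT n → M.diff mul d (M.lie c bra U V) =
      M.lie c bra (M.diff mul d U) V + sg K (m + c) • M.lie c bra U (M.diff mul d V))
    ?_ ?_ ?_ ?_ ?_ hU
  · simp
  · intro m U V _ _ h1 h2 n W hW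
    simp only [map_add, LinearMap.add_apply, h1 hW, h2 hW, smul_add]
    abel
  · intro m r U _ h n W hW
    simp only [map_smul, LinearMap.smul_apply, h hW, smul_add, smul_comm r]
  · simp
  intro i m x U hx hU ihU n V hV
  refine M.gT_induction (P := fun n V => M.diff mul d (M.lie c bra (M.cons x U) V) =
      M.lie c bra (M.diff mul d (M.cons x U)) V +
        sg K (i + m + c) • M.lie c bra (M.cons x U) (M.diff mul d V)) ?_ ?_ ?_ ?_ ?_ hV
  · simp
  · intro m U V _ _ h1 h2
    simp only [map_add, h1, h2, smul_add]
    abel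
  · intro m r U _ h
    simp only [map_smul, h, smul_add, smul_comm r]
  · simp
  intro j n y V hy hV ihV
  have hX := M.cons_mem hx hU
  have hY := M.cons_mem hy hV
  have e1 := congrArg (M.cons x) (ihU hY)
  have e2 := congrArg (M.cons y) ihV
  rw [M.diff_cons hy] at e1
  rw [M.diff_cons hx] at e2
  have hUx := M.absorb_mem_one h hU hx
  have hVy := M.absorb_mem_one h hV hy
  -- The mirror case, where `y` is multiplied into the bracket of `x U` with `V`: the roles of the
  -- two words are exchanged and antisymmetry restores the order.
  have e3 := M.absorb_lie h (V := U) hV hy hx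
  rw [M.lie_anti h hV hX, M.lie_anti h hVy hX, M.lie_anti h hVy hU, M.lie_anti h hV hU,
    h.bra_anti hy hx, h.mul_comm hy hx, negOnePow_smul_eq (K := K)] at e3
  rw [M.lie_cons_cons hx hU hy, map_add, map_add, map_smul, map_smul, M.diff_cons hx,
    M.diff_cons hy, M.diff_cons (h.bra_mem hx hy), M.diff_cons hx, M.diff_cons hy,
    M.absorb_lie h hU hx hy, M.absorb_sh _ hU hV, M.diff_sh h hU hV, h.d_bra hx hy,
    negOnePow_smul_eq (K := K)]
  simp only [map_add, map_smul, LinearMap.add_apply, LinearMap.smul_apply] at e1 e2 e3 ⊢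
  rw [M.lie_cons_cons (h.d_mem hx) hU hy, M.lie_cons_cons hx (M.diff_mem h hU) hy,
    M.lie_cons_cons hx hU (h.d_mem hy), M.lie_cons_cons hx hU hy]
  linear_combination (norm := skip) sg K i • e1 + (sg K (j * (c + (i + m))) * sg K j) • e2 -
    (sg K (j * (c + (i + m))) * sg K j * sg K ((n + c) * (i + m + c))) • e3
  match_scalars <;>
    (try simp only [mul_add, add_mul, sg_add, sg_sq, mul_comm, mul_left_comm, sg_one, mul_one,
      one_mul]) <;> ring_nf <;>
    try simp only [sg_pow_two, sg_pow_three, sg_pow_four, sg_pow_five, mul_one, one_mul, sub_self,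
      neg_add_cancel, add_neg_cancel]

end WordModel

/-! ### Shuffle permutations as interleavings -/

/-- All interleavings of two lists. -/
def interl {ι : Type*} : List ι → List ι → List (List ι)
  | [], v => [v]
  | i :: u, [] => [i :: u]
  | i :: u, j :: v => (interl u (j :: v)).map (i :: ·) ++ (interl (i :: u) v).map (j :: ·)

section Interleavings

variable {ι : Type*}

@[simp] theorem interl_nil_right (u : List ι) : interl u [] = [u] := by
  cases u <;> simp [interl]

/-- If a predicate separates the entries of `u` from those of `v`, an interleaving is recognised by
its two sublists. This replaces the recursive definition by a condition that can be compared with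
monotonicity of a permutation. -/
theorem mem_interl (L : ι → Prop) [DecidablePred L] (l : List ι) : ∀ {u v : List ι},
    (∀ i ∈ u, L i) → (∀ j ∈ v, ¬ L j) →
      (l ∈ interl u v ↔ l.filter (L ·) = u ∧ l.filter (¬ L ·) = v) := by
  induction l with
  | nil =>
    rintro (_ | ⟨i, u⟩) (_ | ⟨j, v⟩) _ _ <;> simp [interl]
  | cons a l ih =>
    rintro (_ | ⟨i, u⟩) (_ | ⟨j, v⟩) hu hv
    · simp [interl]
      by_cases ha : L a <;> simp [ha]
    · have h0 := ih (u := []) (v := v) (by simp) (fun j hj => hv j (by simp [hj]))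
      have hj := hv j (by simp)
      simp only [interl, List.mem_singleton] at h0 ⊢
      by_cases ha : L a
      · simp only [ha, decide_true, List.filter_cons_of_pos, reduceCtorEq, false_and, iff_false]
        rintro ⟨⟩
        exact hj ha
      · simp only [ha, decide_false, Bool.false_eq_true, not_false_eq_true,
          List.filter_cons_of_neg, decide_true, List.filter_cons_of_pos, List.cons.injEq, h0]
        tauto
    · have h0 := ih (u := u) (v := []) (fun j hj => hu j (by simp [hj])) (by simp)
      have hi := hu i (by simp)
      simp only [interl_nil_right, List.mem_singleton] at h0 ⊢
      by_cases ha : L a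
      · simp only [ha, decide_true, List.filter_cons_of_pos, List.cons.injEq, h0, not_true,
          decide_false, Bool.false_eq_true, not_false_eq_true, List.filter_cons_of_neg]
        tauto
      · simp only [ha, decide_false, Bool.false_eq_true, not_false_eq_true,
          List.filter_cons_of_neg, decide_true, List.filter_cons_of_pos, reduceCtorEq, and_false,
          iff_false]
        rintro ⟨⟩
        exact ha hi
    · have h1 := ih (u := u) (v := j :: v) (fun j hj => hu j (by simp [hj])) hv
      have h2 := ih (u := i :: u) (v := v) hu (fun j hj => hv j (by simp [hj]))
      have hi := hu i (by simp)
      have hj := hv j (by simp)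
      simp only [interl, List.mem_append, List.mem_map, List.cons.injEq]
      by_cases ha : L a
      · have haj : j ≠ a := by rintro rfl; exact hj ha
        simp only [ha, decide_true, List.filter_cons_of_pos, List.cons.injEq, h1, not_true,
          decide_false, Bool.false_eq_true, not_false_eq_true, List.filter_cons_of_neg, haj,
          false_and, and_false, exists_false, or_false]
        constructor
        · rintro ⟨l', hl', rfl, rfl⟩
          have := h1.1 hl'
          tauto
        · rintro ⟨⟨rfl, h3⟩, h4⟩
          exact ⟨l, h1.2 ⟨h3, h4⟩, rfl, rfl⟩
      · have hai : i ≠ a := by rintro rfl; exact ha hi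
        simp only [ha, decide_true, List.filter_cons_of_pos, List.cons.injEq, h1, not_true,
          decide_false, Bool.false_eq_true, not_false_eq_true, List.filter_cons_of_neg, hai,
          false_and, and_false, exists_false, false_or]
        constructor
        · rintro ⟨l', hl', rfl, rfl⟩
          have := h2.1 hl'
          tauto
        · rintro ⟨h3, rfl, h4⟩
          exact ⟨l, h2.2 ⟨h3, h4⟩, rfl, rfl⟩

theorem nodup_interl (L : ι → Prop) : ∀ {u v : List ι},
    (∀ i ∈ u, L i) → (∀ j ∈ v, ¬ L j) → (interl u v).Nodup
  | [], v, _, _ => by simp [interl]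
  | i :: u, [], _, _ => by simp [interl]
  | i :: u, j :: v, hu, hv => by
    have h1 := nodup_interl L (u := u) (v := j :: v) (fun j hj => hu j (by simp [hj])) hv
    have h2 := nodup_interl L (u := i :: u) (v := v) hu (fun j hj => hv j (by simp [hj]))
    have hi := hu i (by simp)
    have hj := hv j (by simp)
    rw [interl, List.nodup_append]
    refine ⟨h1.map (fun _ _ h => by simpa using h), h2.map (fun _ _ h => by simpa using h), ?_⟩
    rintro _ h3 _ h4 rfl
    obtain ⟨l, _, rfl⟩ := List.mem_map.1 h3
    obtain ⟨l', _, h⟩ := List.mem_map.1 h4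
    obtain ⟨rfl, _⟩ := List.cons.inj h
    exact hj hi

theorem perm_of_mem_interl : ∀ {u v l : List ι}, l ∈ interl u v → l.Perm (u ++ v)
  | [], v, l, h => by simp_all [interl]
  | i :: u, [], l, h => by simp_all [interl]
  | i :: u, j :: v, l, h => by
    rw [interl, List.mem_append] at h
    rcases h with h | h
    · obtain ⟨l', hl', rfl⟩ := List.mem_map.1 h
      exact (perm_of_mem_interl hl').cons i
    · obtain ⟨l', hl', rfl⟩ := List.mem_map.1 h
      exact ((perm_of_mem_interl hl').cons j).trans List.perm_middle.symm

variable {p q : ℕ}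

theorem mem_Bat_iff (σ : Equiv.Perm (Fin (p + q))) : σ ∈ Bat p q ↔
    List.ofFn ⇑σ⁻¹ ∈ interl ((List.finRange p).map (Fin.castAdd q))
      ((List.finRange q).map (Fin.natAdd p)) := by
  set l := List.ofFn ⇑σ⁻¹ with hl
  have hu : ((List.finRange p).map (Fin.castAdd q)).Pairwise (· < ·) := by
    rw [List.pairwise_map]
    exact (List.pairwise_lt_finRange p).imp fun h => Fin.lt_def.2 h
  have hv : ((List.finRange q).map (Fin.natAdd p)).Pairwise (· < ·) := by
    rw [List.pairwise_map]
    exact (List.pairwise_lt_finRange q).imp fun h => Fin.lt_def.2 (Nat.add_lt_add_left h p)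
  have hmem : ∀ i, i ∈ l := fun i => by
    rw [hl, List.mem_ofFn]
    exact ⟨σ i, by simp⟩
  have hnd : l.Nodup := List.nodup_ofFn.2 (σ⁻¹).injective
  have pw (R : Fin (p + q) → Fin (p + q) → Prop) : l.Pairwise R ↔ ∀ i j, σ i < σ j → R i j := by
    rw [hl, List.pairwise_ofFn]
    constructor
    · intro h i j hij
      simpa using h hij
    · intro h i j hij
      exact h _ _ (by simpa using hij)
  have inv (R : Fin (p + q) → Prop) : (∀ i j, σ i < σ j → R i → R j → i < j) ↔
      ∀ i j, i < j → R i → R j → σ i < σ j := by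
    constructor
    · intro h i j hij hi hj
      rcases lt_trichotomy (σ i) (σ j) with h1 | h1 | h1
      · exact h1
      · exact absurd (σ.injective h1) hij.ne
      · exact absurd (h _ _ h1 hj hi) hij.asymm
    · intro h i j hij hi hj
      rcases lt_trichotomy i j with h1 | h1 | h1
      · exact h1
      · exact absurd (h1 ▸ hij) (lt_irrefl _)
      · exact absurd (h _ _ h1 hj hi) hij.asymm
  -- The sublist of `l` in `R` is a permutation of the increasing list `u`, so it equals `u` exactly
  -- when it is increasing.
  have key (R : Fin (p + q) → Prop) [DecidablePred R] (u : List (Fin (p + q)))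
      (hu : u.Pairwise (· < ·)) (hR : ∀ i, i ∈ u ↔ R i) : l.filter (R ·) = u ↔
      ∀ i j, i < j → R i → R j → σ i < σ j := by
    rw [← inv, ← pw (fun i j => R i → R j → i < j)]
    have h1 : l.Pairwise (fun i j => R i → R j → i < j) ↔
        (l.filter (R ·)).Pairwise (· < ·) := by
      rw [List.pairwise_filter]; simp
    rw [h1]
    constructor
    · rintro rfl; exact hu
    · intro h
      refine List.Perm.eq_of_pairwise (fun a b _ _ h1 h2 => absurd h1 h2.asymm) h hu ?_
      rw [List.perm_ext_iff_of_nodup (hnd.filter _) (hu.imp ne_of_lt)]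
      simp [hmem, hR]
  rw [mem_interl (fun i : Fin (p + q) => (i : ℕ) < p) l, key (fun i : Fin (p + q) => (i : ℕ) < p) _ hu,
    key (fun i : Fin (p + q) => ¬ (i : ℕ) < p) _ hv]
  · simp only [Bat, Finset.mem_filter, Finset.mem_univ, true_and]
    refine and_congr ?_ ?_
    · exact ⟨fun h i j hij _ hj => h i j hij hj,
        fun h i j hij hj => h i j hij (lt_trans (by simpa using hij) hj) hj⟩
    · exact ⟨fun h i j hij hi _ => h i j hij (not_lt.1 hi),
        fun h i j hij hi => h i j hij (not_lt.2 hi)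
          (not_lt.2 (hi.trans (le_of_lt (by simpa using hij))))⟩
  · intro i
    refine Fin.addCases (fun i => ?_) (fun i => ?_) i <;> simp [Fin.ext_iff] <;> omega
  · intro i
    refine Fin.addCases (fun i => ?_) (fun i => ?_) i <;> simp [Fin.ext_iff] <;> omega
  · simp
  · simp

/-- The point is to replace a sum over permutations by one that can be computed by recursion on the
two words. An interleaving of the two blocks lists each index once, hence is `σ⁻¹` for a unique `σ`.
-/
theorem sum_Bat {N : Type*} [AddCommMonoid N] (F : List (Fin (p + q)) → N) :
    ∑ σ ∈ Bat p q, F (List.ofFn ⇑σ⁻¹) =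
      ((interl ((List.finRange p).map (Fin.castAdd q))
        ((List.finRange q).map (Fin.natAdd p))).map F).sum := by
  have hnd : (interl ((List.finRange p).map (Fin.castAdd q))
      ((List.finRange q).map (Fin.natAdd p))).Nodup :=
    nodup_interl (fun i : Fin (p + q) => (i : ℕ) < p) (by simp) (by simp)
  rw [← List.sum_toFinset _ hnd]
  refine Finset.sum_bij (fun σ _ => List.ofFn ⇑σ⁻¹) ?_ ?_ ?_ ?_
  · intro σ hσ
    simpa using (mem_Bat_iff σ).1 hσ
  · intro σ _ τ _ h
    have := List.ofFn_injective h
    exact inv_injective (DFunLike.coe_injective this)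
  · intro l hl
    rw [List.mem_toFinset] at hl
    have hp := perm_of_mem_interl hl
    have hlen : l.length = p + q := by simpa using hp.length_eq
    have hn : l.Nodup := by
      rw [hp.nodup_iff, List.nodup_append]
      refine ⟨(List.nodup_finRange p).map (Fin.castAdd_injective p q),
        (List.nodup_finRange q).map (Fin.natAdd_injective q p), ?_⟩
      intro a ha b hb
      obtain ⟨i, _, rfl⟩ := List.mem_map.1 ha
      obtain ⟨j, _, rfl⟩ := List.mem_map.1 hb
      simp [Fin.ext_iff]; omega
    let g : Fin (p + q) → Fin (p + q) := fun i => l.get (i.cast hlen.symm)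
    have hg : Function.Injective g := fun i j h => by
      simpa [Fin.ext_iff] using List.nodup_iff_injective_get.1 hn h
    let τ : Equiv.Perm (Fin (p + q)) := Equiv.ofBijective g (Finite.injective_iff_bijective.1 hg)
    have hτ : List.ofFn ⇑(τ⁻¹)⁻¹ = l := by
      rw [inv_inv]
      refine List.ext_get (by simp [hlen]) fun n h1 h2 => ?_
      simp [τ, g]
    exact ⟨τ⁻¹, (mem_Bat_iff _).2 (hτ ▸ hl), hτ⟩
  · intro σ _
    rfl

end Interleavings

/-! ### Koszul signs of interleavings -/

section Koszul

variable {ι : Type*} [LinearOrder ι]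

variable (K) in
/-- The product of the signs `(-1)^{D i · D j}` over the inversions of a list. -/
def koszList (D : ι → ℤ) : List ι → K
  | [] => 1
  | i :: l => (l.map fun j => if j < i then sg K (D i * D j) else 1).prod * koszList D l

theorem koszList_ofFn (D : ι → ℤ) : ∀ {n : ℕ} (π : Fin n → ι),
    koszList K D (List.ofFn π) =
      ∏ s, ∏ t, if s < t ∧ π t < π s then sg K (D (π s) * D (π t)) else 1
  | 0, π => by simp [koszList]
  | n + 1, π => by
    rw [List.ofFn_succ, koszList, koszList_ofFn, Fin.prod_univ_succ, Fin.prod_univ_succ]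
    simp only [Fin.prod_univ_succ, lt_irrefl, false_and, if_false, one_mul, Fin.succ_pos, true_and,
      Fin.not_lt_zero, Fin.succ_lt_succ_iff, List.map_ofFn, List.prod_ofFn, Function.comp]

variable {A : Type*} [AddCommGroup A] [Module K A] {𝒜 : ℤ → Submodule K A}

theorem koszul_eq_koszList (a : ℤ) {n : ℕ} (w : Fin n → HomEl 𝒜) (σ : Equiv.Perm (Fin n)) :
    ((koszul a w σ : ℤ) : K) = koszList K (fun i => dg a (w i)) (List.ofFn ⇑σ⁻¹) := by
  rw [koszList_ofFn, koszul, Finset.prod_filter]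
  push_cast
  rw [← Fintype.prod_prod_type' (f := fun s t => if s < t ∧ σ⁻¹ t < σ⁻¹ s then
    sg K (dg a (w (σ⁻¹ s)) * dg a (w (σ⁻¹ t))) else 1)]
  -- One product runs over inverted pairs of letters, the other over pairs of positions. The swap is
  -- needed because the smaller letter of an inversion stands at the later position.
  refine Fintype.prod_equiv ((Equiv.prodComm _ _).trans (Equiv.prodCongr σ σ)) _ _ ?_
  rintro ⟨i, j⟩
  simp only [Equiv.trans_apply, Equiv.prodComm_apply, Prod.swap, Equiv.prodCongr_apply, Prod.map,
    Equiv.Perm.coe_inv, Equiv.symm_apply_apply, and_comm (a := i < j)]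
  split_ifs <;> simp [sg, mul_comm]

theorem prod_inversions_eq_one (D : ι → ℤ) (i : ι) (l : List ι) (h : ∀ j ∈ l, i < j) :
    (l.map fun j => if j < i then sg K (D i * D j) else 1).prod = 1 := by
  refine List.prod_eq_one fun x hx => ?_
  obtain ⟨j, hj, rfl⟩ := List.mem_map.1 hx
  rw [if_neg (h j hj).asymm]

theorem prod_inversions_eq_sg (D : ι → ℤ) (j : ι) (l : List ι) (h : ∀ i ∈ l, i < j) :
    (l.map fun i => if i < j then sg K (D j * D i) else 1).prod = sg K (D j * (l.map D).sum) := by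
  induction l with
  | nil => simp
  | cons i l ih =>
    rw [List.map_cons, List.prod_cons, if_pos (h i (by simp)), ih (fun k hk => h k (by simp [hk])),
      List.map_cons, List.sum_cons, mul_add, sg_add]

theorem koszList_sorted (D : ι → ℤ) {l : List ι} (h : l.Pairwise (· < ·)) :
    koszList K D l = 1 := by
  induction h with
  | nil => rfl
  | cons h _ ih => rw [koszList, ih, prod_inversions_eq_one D _ _ h, one_mul]

theorem koszList_cons_left (D : ι → ℤ) {i : ι} {u v l : List ι} (hl : l ∈ interl u v)
    (h : (i :: (u ++ v)).Pairwise (· < ·)) : koszList K D (i :: l) = koszList K D l := by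
  rw [koszList, prod_inversions_eq_one, one_mul]
  intro j hj
  exact List.rel_of_pairwise_cons h ((perm_of_mem_interl hl).mem_iff.1 hj)

/-- The head `j` is inverted with every entry of `u` and with none of `v`, which is the sign in the
second term of the shuffle recursion. -/
theorem koszList_cons_right (D : ι → ℤ) {j : ι} {u v l : List ι} (hl : l ∈ interl u v)
    (h : (u ++ j :: v).Pairwise (· < ·)) :
    koszList K D (j :: l) = sg K (D j * (u.map D).sum) * koszList K D l := by
  rw [koszList, ((perm_of_mem_interl hl).map _).prod_eq, List.map_append, List.prod_append]
  rw [List.pairwise_append, List.pairwise_cons] at h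
  rw [prod_inversions_eq_one D j v h.2.1.1, mul_one,
    prod_inversions_eq_sg D j u fun i hi => h.2.2 i hi j (by simp)]

end Koszul

/-! ### Explicit sums as recursive operations -/

namespace WordModel

variable {A T I : Type*} [AddCommGroup A] [Module K A] [AddCommGroup T] [Module K T]
  (M : WordModel K A T I)

/-- The word with the given letters. -/
noncomputable def ofLetters : List A → T
  | [] => M.word []
  | x :: l => M.cons x (ofLetters l)

variable {ι : Type*} (f : ι → A) (D : ι → ℤ)

/-- The signed sum of all words obtained by applying `d` to a letter. -/
noncomputable def letterSum (d : A →ₗ[K] A) : List ι → T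
  | [] => 0
  | i :: l => M.cons (d (f i)) (M.ofLetters (l.map f)) +
      sg K (D i) • M.cons (f i) (letterSum d l)

/-- The signed sum of all words obtained by merging two adjacent letters. -/
noncomputable def mergeSum (c : ℤ) (m : ι → ι → A) : List ι → T
  | [] => 0
  | [_] => 0
  | i :: j :: l => M.cons (m i j) (M.ofLetters (l.map f)) +
      sg K (c * D i) • M.cons (f i) (mergeSum c m (j :: l))

variable {f D}

theorem ofLetters_mem (hf : ∀ i, f i ∈ M.gA (D i)) (l : List ι) :
    M.ofLetters (l.map f) ∈ M.gT (l.map D).sum := by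
  induction l with
  | nil => exact M.one_mem
  | cons i l ih => exact M.cons_mem (hf i) ih

theorem diff_ofLetters (mul : A →ₗ[K] A →ₗ[K] A) (d : A →ₗ[K] A) (hf : ∀ i, f i ∈ M.gA (D i))
    (l : List ι) : M.diff mul d (M.ofLetters (l.map f)) = M.letterSum f D d l +
      M.mergeSum f D 1 (fun i j => sg K (D i) • mul (f i) (f j)) l := by
  induction l with
  | nil => simp [ofLetters, letterSum, mergeSum]
  | cons i l ih =>
    rw [List.map_cons, ofLetters, M.diff_cons (hf i), ih]
    cases l with
    | nil => simp [ofLetters, letterSum, mergeSum]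
    | cons j l =>
      simp only [letterSum, mergeSum, List.map_cons, ofLetters, absorb_cons, sh_one, one_mul,
        map_add, map_smul, LinearMap.smul_apply]
      module

theorem mergeSum_eq_zero (c : ℤ) (m : ι → ι → A) {l : List ι} (h : ∀ i ∈ l, ∀ j ∈ l, m i j = 0) :
    M.mergeSum f D c m l = 0 := by
  induction l with
  | nil => rfl
  | cons i l ih =>
    cases l with
    | nil => rfl
    | cons j l =>
      rw [mergeSum, ih fun i hi j hj => h i (by simp [hi]) j (by simp [hj]), h i (by simp) j
        (by simp)]
      simp

/-- The part of `mergeSum` that merges the first letter with the following one. -/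
noncomputable def mergeHead (f : ι → A) (m : ι → ι → A) (i : ι) : List ι → T
  | [] => 0
  | j :: l => M.cons (m i j) (M.ofLetters (l.map f))

theorem mergeSum_cons (c : ℤ) (m : ι → ι → A) (i : ι) (l : List ι) :
    M.mergeSum f D c m (i :: l) = M.mergeHead f m i l +
      sg K (c * D i) • M.cons (f i) (M.mergeSum f D c m l) := by
  cases l <;> simp [mergeSum, mergeHead]

theorem mergeHead_eq_zero (m : ι → ι → A) (i : ι) {l : List ι} (h : ∀ j ∈ l, m i j = 0) :
    M.mergeHead f m i l = 0 := by
  cases l with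
  | nil => rfl
  | cons j l => rw [mergeHead, h j (by simp)]; simp

variable [LinearOrder ι]

theorem sum_interl_ofLetters (hf : ∀ i, f i ∈ M.gA (D i)) : ∀ {u v : List ι},
    (u ++ v).Pairwise (· < ·) →
    ((interl u v).map fun l => koszList K D l • M.ofLetters (l.map f)).sum =
      M.sh (M.ofLetters (u.map f)) (M.ofLetters (v.map f))
  | [], v, h => by
    rw [List.nil_append] at h
    simp [interl, ofLetters, koszList_sorted D h]
  | i :: u, [], h => by
    rw [List.append_nil] at h
    simp [ofLetters, koszList_sorted D h]
  | i :: u, j :: v, h => by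
    have h1 := sum_interl_ofLetters hf (u := u) (v := j :: v) h.of_cons
    have h' : (i :: u ++ v).Pairwise (· < ·) :=
      h.sublist (List.Sublist.append_left (List.sublist_cons_self j v) (i :: u))
    have h2 := sum_interl_ofLetters hf (u := i :: u) (v := v) h'
    rw [List.map_cons, List.map_cons, ofLetters, ofLetters,
      M.sh_cons_cons (hf i) (M.ofLetters_mem hf u) (hf j), interl, List.map_append,
      List.sum_append, List.map_map, List.map_map]
    rw [List.map_cons, ofLetters] at h1 h2
    rw [← h1, ← h2, map_list_sum, map_list_sum, List.smul_sum, List.map_map, List.map_map,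
      List.map_map]
    congr 2
    · refine List.map_congr_left fun l hl => ?_
      simp only [Function.comp, List.map_cons, ofLetters, map_smul, koszList_cons_left D hl h]
    · refine List.map_congr_left fun l hl => ?_
      simp only [Function.comp, List.map_cons, ofLetters, map_smul, koszList_cons_right D hl h,
        List.sum_cons, smul_smul]

/-- Since `m i` vanishes on `u`, only interleavings that begin with `j` contribute. They give the
third term of `lie_cons_cons`. -/
theorem sum_interl_mergeHead (hf : ∀ i, f i ∈ M.gA (D i)) (m : ι → ι → A) (i j : ι)
    {u v : List ι} (hu : ∀ k ∈ u, m i k = 0) (h : (u ++ j :: v).Pairwise (· < ·)) :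
    ((interl u (j :: v)).map fun l => koszList K D l • M.mergeHead f m i l).sum =
      sg K (D j * (u.map D).sum) •
        M.cons (m i j) (M.sh (M.ofLetters (u.map f)) (M.ofLetters (v.map f))) := by
  have h' : (u ++ v).Pairwise (· < ·) :=
      h.sublist (List.Sublist.append_left (List.sublist_cons_self j v) u)
  have key : ((interl u (j :: v)).map fun l => koszList K D l • M.mergeHead f m i l).sum =
      ((interl u v).map fun l => koszList K D (j :: l) • M.mergeHead f m i (j :: l)).sum := by
    cases u with
    | nil => simp [interl]
    | cons k u =>
      rw [interl, List.map_append, List.sum_append, List.map_map, List.map_map]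
      rw [List.sum_eq_zero, zero_add]
      · rfl
      · intro x hx
        obtain ⟨l, _, rfl⟩ := List.mem_map.1 hx
        simp [mergeHead, hu k (by simp)]
  rw [key, ← M.sum_interl_ofLetters hf h', map_list_sum, List.smul_sum, List.map_map, List.map_map]
  congr 1
  refine List.map_congr_left fun l hl => ?_
  simp only [Function.comp, mergeHead, map_smul, koszList_cons_right D hl h, smul_smul]

/-- The sum obeys the recursion of `lie_cons_cons`: a head `i` from `u` either stays or merges with
`j`, and a head `j` from `v` never merges with its successor. The explicit sum carries the bracket
symbol in from the left of the word, while `lie` has it after `u`; hence the factor in front. -/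
theorem sum_interl_mergeSum (hf : ∀ i, f i ∈ M.gA (D i)) (c : ℤ) (bra : A →ₗ[K] A →ₗ[K] A)
    (m : ι → ι → A) : ∀ {u v : List ι},
    (∀ i ∈ u, ∀ k ∈ u, m i k = 0) → (∀ j ∈ v, ∀ i, m j i = 0) →
    (∀ i ∈ u, ∀ j ∈ v, m i j = sg K (c * D i) • bra (f i) (f j)) →
    (u ++ v).Pairwise (· < ·) →
    ((interl u v).map fun l => koszList K D l • M.mergeSum f D c m l).sum =
      sg K (c * (u.map D).sum) •
        M.lie c bra (M.ofLetters (u.map f)) (M.ofLetters (v.map f))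
  | [], v, hu, hv, huv, h => by
    simp [interl, ofLetters, M.mergeSum_eq_zero c m fun i hi j _ => hv i hi j]
  | i :: u, [], hu, hv, huv, h => by
    simp [ofLetters, M.mergeSum_eq_zero c m hu]
  | i :: u, j :: v, hu, hv, huv, h => by
    have h1 := sum_interl_mergeSum hf c bra m (u := u) (v := j :: v)
      (fun i hi k hk => hu i (by simp [hi]) k (by simp [hk])) hv
      (fun i hi => huv i (by simp [hi])) h.of_cons
    have h' : (i :: u ++ v).Pairwise (· < ·) :=
      h.sublist (List.Sublist.append_left (List.sublist_cons_self j v) (i :: u))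
    have h2 := sum_interl_mergeSum hf c bra m (u := i :: u) (v := v) hu
      (fun i hi => hv i (by simp [hi]))
      (fun i hi j hj => huv i hi j (by simp [hj])) h'
    have h3 := M.sum_interl_mergeHead hf m i j (fun k hk => hu i (by simp) k (by simp [hk]))
      h.of_cons
    have e1 : ((interl u (j :: v)).map fun l =>
        koszList K D (i :: l) • M.mergeSum f D c m (i :: l)).sum =
        ((interl u (j :: v)).map fun l => koszList K D l • M.mergeHead f m i l).sum +
        sg K (c * D i) • M.cons (f i) ((interl u (j :: v)).map fun l =>
          koszList K D l • M.mergeSum f D c m l).sum := by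
      rw [map_list_sum, List.smul_sum, List.map_map, List.map_map, ← List.sum_map_add]
      refine congrArg List.sum (List.map_congr_left fun l hl => ?_)
      simp only [koszList_cons_left D hl h, mergeSum_cons, map_smul, smul_add, Function.comp,
        smul_comm (koszList K D l)]
    have e2 : ((interl (i :: u) v).map fun l =>
        koszList K D (j :: l) • M.mergeSum f D c m (j :: l)).sum =
        (sg K (D j * ((i :: u).map D).sum) * sg K (c * D j)) • M.cons (f j)
          ((interl (i :: u) v).map fun l => koszList K D l • M.mergeSum f D c m l).sum := by
      rw [map_list_sum, List.smul_sum, List.map_map, List.map_map]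
      refine congrArg List.sum (List.map_congr_left fun l hl => ?_)
      simp only [koszList_cons_right D hl h, mergeSum_cons, map_smul, Function.comp,
        M.mergeHead_eq_zero m j fun k _ => hv j (by simp) k, zero_add, smul_smul]
      congr 1
      ring
    rw [interl, List.map_append, List.sum_append, List.map_map, List.map_map]
    refine (congrArg₂ (· + ·) e1 e2).trans ?_
    rw [h1, h2, h3, huv i (by simp) j (by simp)]
    simp only [List.map_cons, ofLetters]
    rw [M.lie_cons_cons (hf i) (M.ofLetters_mem hf u) (hf j)]
    simp only [map_smul, LinearMap.smul_apply, List.map_cons, List.sum_cons]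
    match_scalars <;>
    (try simp only [mul_add, add_mul, sg_add, sg_sq, mul_comm, mul_left_comm, sg_one, mul_one,
      one_mul]) <;> ring_nf <;>
    try simp only [sg_pow_two, sg_pow_three, sg_pow_four, sg_pow_five, mul_one, one_mul, sub_self,
      neg_add_cancel, add_neg_cancel]

end WordModel

namespace WordModel

variable {A T I : Type*} [AddCommGroup A] [Module K A] [AddCommGroup T] [Module K T]
  (M : WordModel K A T I) {ι : Type*} (f : ι → A) (D : ι → ℤ)

theorem ofLetters_append_zero (l l' : List A) : M.ofLetters (l ++ 0 :: l') = 0 := by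
  induction l with
  | nil => simp [ofLetters]
  | cons x l ih => rw [List.cons_append, ofLetters, ih, map_zero]

theorem sum_Iio_succ {n : ℕ} (D : Fin (n + 1) → ℤ) (k : Fin n) :
    ∑ s ∈ Finset.Iio k.succ, D s = D 0 + ∑ s ∈ Finset.Iio k, D s.succ := by
  rw [← Finset.filter_gt_eq_Iio, ← Finset.filter_gt_eq_Iio, Finset.sum_filter, Finset.sum_filter,
    Fin.sum_univ_succ]
  simp

theorem sum_letterSum (d : A →ₗ[K] A) : ∀ {n : ℕ} (π : Fin n → ι),
    ∑ k : Fin n, sg K (∑ s ∈ Finset.Iio k, D (π s)) •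
      M.ofLetters ((List.ofFn (f ∘ π)).take k ++ d (f (π k)) :: (List.ofFn (f ∘ π)).drop (k + 1)) =
    M.letterSum f D d (List.ofFn π)
  | 0, π => by simp [letterSum]
  | n + 1, π => by
    have h := sum_letterSum d (fun i => π i.succ)
    rw [Fin.sum_univ_succ, List.ofFn_succ (f := π), letterSum, ← h, map_sum, Finset.smul_sum]
    congr 1
    · have : Finset.Iio (0 : Fin (n + 1)) = ∅ := by ext; simp
      simp [this, List.map_ofFn, ofLetters, Function.comp_def]
    · refine Finset.sum_congr rfl fun k _ => ?_
      rw [sum_Iio_succ, sg_add, ← smul_smul, map_smul]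
      simp [ofLetters, Function.comp_def]

theorem sum_mergeSum (c : ℤ) (m : ι → ι → A) : ∀ {n : ℕ} (π : Fin n → ι),
    ∑ k ∈ (Finset.univ : Finset (Fin n × Fin n)) with (k.2 : ℕ) = k.1 + 1,
      sg K (c * ∑ s ∈ Finset.Iio k.1, D (π s)) •
      M.ofLetters ((List.ofFn (f ∘ π)).take k.1 ++ m (π k.1) (π k.2) ::
        (List.ofFn (f ∘ π)).drop (k.1 + 2)) =
    M.mergeSum f D c m (List.ofFn π)
  | 0, π => by simp [mergeSum]
  | 1, π => by
    rw [Finset.sum_eq_zero]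
    · simp [mergeSum]
    · rintro ⟨i, j⟩ h
      simp at h
  | n + 2, π => by
    have h := sum_mergeSum c m (fun i => π i.succ)
    rw [Finset.sum_filter, Fintype.sum_prod_type] at h ⊢
    rw [List.ofFn_succ (f := π), mergeSum_cons, ← h, map_sum, Finset.smul_sum, Fin.sum_univ_succ]
    congr 1
    · have : Finset.Iio (0 : Fin (n + 2)) = ∅ := by ext; simp
      rw [Fin.sum_univ_succ, Fin.sum_univ_succ]
      simp [this, List.map_ofFn, ofLetters, Function.comp_def, mergeHead]
    · refine Finset.sum_congr rfl fun k _ => ?_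
      rw [map_sum, Finset.smul_sum, Fin.sum_univ_succ]
      have h0 : ¬ 0 = (k : ℕ) + 1 + 1 := by omega
      simp only [Fin.val_zero, Fin.val_succ, h0, if_false, zero_add]
      refine Finset.sum_congr rfl fun j _ => ?_
      simp only [add_left_inj]
      split_ifs
      · rw [sum_Iio_succ, mul_add, sg_add, ← smul_smul, map_smul]
        simp [ofLetters, Function.comp_def]
      · simp

end WordModel

/-! ### The tensor algebra as a space of words, and regrading -/

section TensorModel

universe u

variable {A : Type u} [AddCommGroup A] [Module K A]

theorem tensorAlgebra_basis_apply {κ : Type*} (e : Module.Basis κ K A) (l : FreeMonoid κ) :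
    e.tensorAlgebra l = tens K (l.toList.map e) := by
  have h : FreeAlgebra.basisFreeMonoid K κ l = FreeMonoid.lift (FreeAlgebra.ι K) l := by
    simp [FreeAlgebra.basisFreeMonoid, FreeAlgebra.equivMonoidAlgebraFreeMonoid]
  rw [Module.Basis.tensorAlgebra, Module.Basis.map_apply, h]
  change (TensorAlgebra.equivFreeAlgebra e).symm _ = _
  clear h
  induction l using FreeMonoid.inductionOn' with
  | one => simp [tens]
  | of_mul x xs ih =>
    rw [map_mul, map_mul, ih]
    simp [tens]

/-- Bases of the components of `A` form a homogeneous basis, and words in it form a basis of the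
tensor algebra. The letters carry the degree `dg`. -/
theorem exists_wordModel (a : ℤ) {𝒜 : ℤ → Submodule K A} (h : DirectSum.IsInternal 𝒜) :
    ∃ (I : Type u) (M : WordModel K A (TensorAlgebra K A) I),
      (∀ i, M.gA i = 𝒜 (i + 1 - a)) ∧ (∀ x U, M.cons x U = TensorAlgebra.ι K x * U) ∧
      M.word [] = 1 := by
  let v := fun i => Module.Basis.ofVectorSpace K (𝒜 i)
  let e := h.collectedBasis v
  refine ⟨Σ i, Module.Basis.ofVectorSpaceIndex K (𝒜 i), ⟨e, fun s => s.1 + a - 1, e.tensorAlgebra.reindex FreeMonoid.toList,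
    (LinearMap.mul K _).comp (TensorAlgebra.ι K), ?_⟩, ?_, ?_, ?_⟩
  · intro k l
    simp [Module.Basis.reindex_apply, tensorAlgebra_basis_apply, tens]
  · intro i
    rw [WordModel.gA]
    apply le_antisymm
    · rw [Submodule.span_le]
      rintro _ ⟨s, hs, rfl⟩
      have := h.collectedBasis_mem v s
      have hs : s.1 + a - 1 = i := hs
      rwa [show i + 1 - a = s.1 by omega]
    · have h1 : 𝒜 (i + 1 - a) = (⊤ : Submodule K (𝒜 (i + 1 - a))).map (Submodule.subtype _) := by
        simp
      rw [h1, ← (v (i + 1 - a)).span_eq, Submodule.map_span, Submodule.span_le]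
      rintro _ ⟨_, ⟨s, rfl⟩, rfl⟩
      refine Submodule.subset_span ⟨⟨i + 1 - a, s⟩, by simp, by simp [e]⟩
  · intro x U
    rfl
  · simp [Module.Basis.reindex_apply, tensorAlgebra_basis_apply, tens]

theorem isInternal_shift {V : Type*} [AddCommGroup V] [Module K V] {𝒱 : ℤ → Submodule K V}
    (h : DirectSum.IsInternal 𝒱) (e : ℤ ≃ ℤ) : DirectSum.IsInternal (fun i => 𝒱 (e i)) := by
  rw [DirectSum.isInternal_submodule_iff_iSupIndep_and_iSup_eq_top] at h ⊢
  exact ⟨h.1.comp e.injective, (e.iSup_comp (g := 𝒱)).trans h.2⟩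

/-- With `i = |α| + a - 1` one has `|α| + a = i + 1` and `|α| + b = i + (b - a + 1)`, so every sign
in the axioms is unchanged. -/
theorem IsDGABAlgebra.shifted {a b : ℤ} {𝒜 ℬ : ℤ → Submodule K A}
    {mul bra : A →ₗ[K] A →ₗ[K] A} {d : A →ₗ[K] A} (h : IsDGABAlgebra a b 𝒜 mul bra d)
    (hB : ∀ i, ℬ i = 𝒜 (i + 1 - a)) : IsDGABAlgebra 1 (b - a + 1) ℬ mul bra d where
  isInternal := by
    rw [show ℬ = fun i => 𝒜 ((Equiv.addRight (1 - a)) i) from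
      funext fun i => by rw [hB, Equiv.coe_addRight, add_sub_assoc]]
    exact isInternal_shift h.isInternal _
  mul_mem {i j x y} hx hy := by
    rw [hB] at *
    convert h.mul_mem hx hy using 2
    ring
  bra_mem {i j x y} hx hy := by
    rw [hB] at *
    convert h.bra_mem hx hy using 2
    ring
  d_mem {i x} hx := by
    rw [hB] at *
    convert h.d_mem hx using 2
    ring
  mul_comm {i j x y} hx hy := by
    rw [hB] at hx hy
    convert h.mul_comm hx hy using 4 <;> ring
  mul_assoc := h.mul_assoc
  bra_antisymm {i j x y} hx hy := by
    rw [hB] at hx hy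
    convert h.bra_antisymm hx hy using 5 <;> ring
  jacobi {i j k x y z} hx hy hz := by
    rw [hB] at hx hy hz
    have := h.jacobi hx hy hz
    rw [show i + 1 - a + b = i + (b - a + 1) by ring, show j + 1 - a + b = j + (b - a + 1) by ring,
      show k + 1 - a + b = k + (b - a + 1) by ring] at this
    exact this
  leibniz {i j k x y z} hx hy hz := by
    rw [hB] at hx hy hz
    have := h.leibniz hx hy hz
    rwa [show i + 1 - a + b = i + (b - a + 1) by ring, sub_add_cancel] at this
  d_d := h.d_d
  d_mul {i j x y} hx hy := by
    rw [hB] at hx hy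
    have := h.d_mul hx hy
    rwa [sub_add_cancel] at this
  d_bra {i j x y} hx hy := by
    rw [hB] at hx hy
    have := h.d_bra hx hy
    rwa [show i + 1 - a + b = i + (b - a + 1) by ring] at this

end TensorModel

theorem units_smul_eq {N : Type*} [AddCommGroup N] [Module K N] (u : ℤˣ) (x : N) :
    u • x = ((u : ℤ) : K) • x := by
  rw [Units.smul_def, Int.cast_smul_eq_zsmul]

variable {A : Type*} [AddCommGroup A] [Module K A] {a : ℤ} {𝒜 : ℤ → Submodule K A}

/-! ### The projection to `H` and descent of linear maps -/

section ToH

theorem algebraMapInv_of_mem_Tplus {t : TensorAlgebra K A} (ht : t ∈ Tplus K A) :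
    TensorAlgebra.algebraMapInv t = 0 := by
  have h : Tplus K A ≤ LinearMap.ker (TensorAlgebra.algebraMapInv (R := K) (M := A)).toLinearMap := by
    refine iSup_le fun n => ?_
    rw [pow_succ, Submodule.mul_le]
    rintro x _ _ ⟨y, rfl⟩
    simp [TensorAlgebra.algebraMapInv]
  exact h ht

theorem algebraMapInv_ι_mul (x : A) (t : TensorAlgebra K A) :
    TensorAlgebra.algebraMapInv (TensorAlgebra.ι K x * t) = 0 := by
  simp [TensorAlgebra.algebraMapInv]

theorem span_tens : Submodule.span K (Set.range (tens K (A := A))) = ⊤ := by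
  rw [eq_top_iff]
  rintro t -
  induction t using TensorAlgebra.induction with
  | algebraMap r =>
    rw [Algebra.algebraMap_eq_smul_one]
    exact Submodule.smul_mem _ _ (Submodule.subset_span ⟨[], by simp [tens]⟩)
  | ι x => exact Submodule.subset_span ⟨[x], by simp [tens]⟩
  | add x y hx hy => exact add_mem hx hy
  | mul x y hx hy =>
    have := Submodule.mul_mem_mul hx hy
    rw [Submodule.span_mul_span] at this
    refine Submodule.span_mono ?_ this
    rintro _ ⟨_, ⟨l, rfl⟩, _, ⟨l', rfl⟩, rfl⟩
    exact ⟨l ++ l', by simp [tens]⟩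

variable (K A) in
/-- The projection of the tensor algebra along the scalars. -/
noncomputable def projPlus : TensorAlgebra K A →ₗ[K] TensorAlgebra K A :=
  LinearMap.id - (Algebra.linearMap K _).comp TensorAlgebra.algebraMapInv.toLinearMap

theorem projPlus_apply (t : TensorAlgebra K A) :
    projPlus K A t = t - algebraMap K _ (TensorAlgebra.algebraMapInv t) := rfl

theorem projPlus_of_mem {t : TensorAlgebra K A} (ht : t ∈ Tplus K A) : projPlus K A t = t := by
  rw [projPlus_apply, algebraMapInv_of_mem_Tplus ht, map_zero, sub_zero]

theorem projPlus_one : projPlus K A 1 = 0 := by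
  simp [projPlus_apply]

theorem projPlus_mem (t : TensorAlgebra K A) : projPlus K A t ∈ Tplus K A := by
  have ht : t ∈ Submodule.span K (Set.range (tens K (A := A))) := by rw [span_tens]; trivial
  induction ht using Submodule.span_induction with
  | zero => simp
  | add x y _ _ h1 h2 => rw [map_add]; exact add_mem h1 h2
  | smul r x _ h => rw [map_smul]; exact Submodule.smul_mem _ _ h
  | mem x hx =>
    obtain ⟨_ | ⟨x, l⟩, rfl⟩ := hx
    · simp [tens, projPlus_one]
    · rw [projPlus_of_mem (tens_cons_mem x l)]
      exact tens_cons_mem x l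

variable (a 𝒜) in
/-- The quotient map to `H`, extended by `0` to the scalars. -/
noncomputable def toH : TensorAlgebra K A →ₗ[K] H a 𝒜 :=
  (Submodule.mkQ _).comp ((projPlus K A).codRestrict (Tplus K A) projPlus_mem)

theorem toH_of_mem {t : TensorAlgebra K A} (ht : t ∈ Tplus K A) :
    toH a 𝒜 t = Submodule.Quotient.mk ⟨t, ht⟩ := by
  rw [toH, LinearMap.comp_apply, Submodule.mkQ_apply]
  congr 1
  exact Subtype.ext (projPlus_of_mem ht)

theorem toH_one : toH a 𝒜 1 = 0 := by
  rw [toH, LinearMap.comp_apply, Submodule.mkQ_apply, Submodule.Quotient.mk_eq_zero]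
  change projPlus K A 1 ∈ shuffles a 𝒜
  rw [projPlus_one]
  exact zero_mem _

theorem cls_eq_toH (l : List A) : cls a 𝒜 l = toH a 𝒜 (tens K l) := by
  cases l with
  | nil => rw [cls, show tens K ([] : List A) = 1 by simp [tens], toH_one]
  | cons x l => rw [cls, toH_of_mem (tens_cons_mem x l)]

theorem toH_surjective : Function.Surjective (toH a 𝒜) := by
  intro X
  obtain ⟨⟨t, ht⟩, rfl⟩ := Submodule.Quotient.mk_surjective _ X
  exact ⟨t, toH_of_mem ht⟩

/-- The projection discards the scalar part of a tensor, so `F` must vanish on `1` as well as on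
shuffles. -/
theorem exists_lift {N : Type*} [AddCommGroup N] [Module K N] (F : TensorAlgebra K A →ₗ[K] N)
    (h1 : F 1 = 0) (hS : ∀ t ∈ shuffles a 𝒜, F t = 0) :
    ∃ G : H a 𝒜 →ₗ[K] N, ∀ t, G (toH a 𝒜 t) = F t := by
  refine ⟨Submodule.liftQ _ (F.comp (Tplus K A).subtype) fun t ht =>
    hS t (Submodule.mem_comap.1 ht), fun t => ?_⟩
  rw [toH, LinearMap.comp_apply]
  refine (Submodule.liftQ_apply _ _ _).trans ?_
  change F (projPlus K A t) = F t
  rw [projPlus_apply, map_sub, Algebra.algebraMap_eq_smul_one, map_smul, h1, smul_zero, sub_zero]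

theorem exists_lift₂ {N : Type*} [AddCommGroup N] [Module K N]
    (F : TensorAlgebra K A →ₗ[K] TensorAlgebra K A →ₗ[K] N)
    (h1 : ∀ t, F 1 t = 0) (h1' : ∀ t, F t 1 = 0) (hS : ∀ s ∈ shuffles a 𝒜, ∀ t, F s t = 0)
    (hS' : ∀ t ∈ shuffles a 𝒜, ∀ s, F s t = 0) :
    ∃ G : H a 𝒜 →ₗ[K] H a 𝒜 →ₗ[K] N, ∀ s t, G (toH a 𝒜 s) (toH a 𝒜 t) = F s t := by
  obtain ⟨G, hG⟩ := exists_lift (a := a) (𝒜 := 𝒜) F (LinearMap.ext h1)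
    fun s hs => LinearMap.ext (hS s hs)
  obtain ⟨G', hG'⟩ := exists_lift (a := a) (𝒜 := 𝒜) G.flip
    (LinearMap.ext fun X => by
      obtain ⟨s, rfl⟩ := toH_surjective X
      simp [hG, h1'])
    (fun t ht => LinearMap.ext fun X => by
      obtain ⟨s, rfl⟩ := toH_surjective X
      simp [hG, hS' t ht])
  exact ⟨G'.flip, fun s t => by simp [hG', hG]⟩

end ToH

/-! ### The explicit formulas in terms of the operations on words -/

namespace WordModel

variable {I : Type*}

section Scale

variable {T : Type*} [AddCommGroup T] [Module K T] (M : WordModel K A T I)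

/-- The operator that multiplies the elements of degree `m` by `χ m`. -/
noncomputable def scale (χ : ℤ → K) : T →ₗ[K] T :=
  M.word.constr K fun l => χ (M.wdeg l) • M.word l

theorem scale_of_mem (χ : ℤ → K) {m : ℤ} {U : T} (hU : U ∈ M.gT m) :
    M.scale χ U = χ m • U := by
  induction hU using Submodule.span_induction with
  | zero => simp
  | add x y _ _ h1 h2 => rw [map_add, h1, h2, smul_add]
  | smul r x _ h => rw [map_smul, h, smul_comm]
  | mem x hx =>
    obtain ⟨l, rfl, rfl⟩ := hx
    simp [scale, Module.Basis.constr_basis]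

end Scale

variable (M : WordModel K A (TensorAlgebra K A) I)

/-- The word model is built from the tensor algebra of the graded space `A[-a+1]`. -/
structure IsTensorModel (M : WordModel K A (TensorAlgebra K A) I) (a : ℤ)
    (𝒜 : ℤ → Submodule K A) : Prop where
  gA_eq : ∀ i, M.gA i = 𝒜 (i + 1 - a)
  cons_eq : ∀ x U, M.cons x U = TensorAlgebra.ι K x * U
  one_eq : M.word [] = 1

variable {M}

namespace IsTensorModel

variable (hM : M.IsTensorModel a 𝒜)
include hM

theorem ofLetters_eq (l : List A) : M.ofLetters l = tens K l := by
  induction l with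
  | nil => rw [ofLetters, hM.one_eq]; simp [tens]
  | cons x l ih => rw [ofLetters, hM.cons_eq, ih]; simp [tens]

theorem letter_mem_gA (x : HomEl 𝒜) : (x.2 : A) ∈ M.gA (dg a x) := by
  rw [hM.gA_eq, dg, sub_add_cancel, add_sub_cancel_right]
  exact x.2.2

theorem tens_letters_mem {n : ℕ} (w : Fin n → HomEl 𝒜) :
    tens K (letters w) ∈ M.gT (degWord a w) := by
  have := M.ofLetters_mem (f := fun i => ((w i).2 : A)) (D := fun i => dg a (w i))
    (fun i => hM.letter_mem_gA (w i)) (List.finRange n)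
  rw [hM.ofLetters_eq, ← List.ofFn_eq_map, ← List.ofFn_eq_map, List.sum_ofFn] at this
  exact this

theorem exists_word (l : List I) : ∃ w : Fin l.length → HomEl 𝒜,
    M.word l = tens K (letters w) ∧ degWord a w = M.wdeg l := by
  have hmem (k : I) : M.letter k ∈ 𝒜 (M.deg k + 1 - a) := hM.gA_eq _ ▸ M.letter_mem k
  refine ⟨fun i => ⟨M.deg (l.get i) + 1 - a, M.letter (l.get i), hmem _⟩, ?_, ?_⟩
  · have h : ∀ l : List I, M.word l = M.ofLetters (l.map M.letter) := by
      intro l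
      induction l with
      | nil => rfl
      | cons k l ih => rw [List.map_cons, ofLetters, ← ih, M.cons_word]
    rw [h, hM.ofLetters_eq, letters]
    congr 1
    refine List.ext_get (by simp) fun n h1 h2 => by simp
  · simp only [degWord, dg]
    rw [wdeg, ← List.sum_ofFn]
    congr 1
    refine List.ext_get (by simp) fun n h1 h2 => by simp

section Formulas

variable {p q : ℕ} (u : Fin p → HomEl 𝒜) (v : Fin q → HomEl 𝒜)

omit hM in
theorem pairwise_finRange_append : ((List.finRange p).map (Fin.castAdd q) ++
    (List.finRange q).map (Fin.natAdd p)).Pairwise (· < ·) := by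
  rw [List.pairwise_append]
  refine ⟨?_, ?_, ?_⟩
  · rw [List.pairwise_map]
    exact (List.pairwise_lt_finRange p).imp fun h => Fin.lt_def.2 h
  · rw [List.pairwise_map]
    exact (List.pairwise_lt_finRange q).imp fun h => Fin.lt_def.2 (Nat.add_lt_add_left h p)
  · intro i hi j hj
    obtain ⟨i, _, rfl⟩ := List.mem_map.1 hi
    obtain ⟨j, _, rfl⟩ := List.mem_map.1 hj
    rw [Fin.lt_def, Fin.val_castAdd, Fin.val_natAdd]
    omega

omit hM in
theorem map_castAdd {β : Type*} (f : HomEl 𝒜 → β) :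
    ((List.finRange p).map (Fin.castAdd q)).map (fun i => f (Fin.append u v i)) =
      List.ofFn fun i => f (u i) := by
  rw [List.map_map, List.ofFn_eq_map]
  simp [Function.comp_def]

omit hM in
theorem map_natAdd {β : Type*} (f : HomEl 𝒜 → β) :
    ((List.finRange q).map (Fin.natAdd p)).map (fun i => f (Fin.append u v i)) =
      List.ofFn fun i => f (v i) := by
  rw [List.map_map, List.ofFn_eq_map]
  simp [Function.comp_def]

theorem bat_eq : bat a u v = M.sh (tens K (letters u)) (tens K (letters v)) := by
  have h := M.sum_interl_ofLetters (f := fun i => ((Fin.append u v i).2 : A))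
    (D := fun i => dg a (Fin.append u v i)) (fun i => hM.letter_mem_gA _)
    (pairwise_finRange_append (p := p) (q := q))
  rw [map_castAdd u v (fun x => (x.2 : A)), map_natAdd u v (fun x => (x.2 : A)), hM.ofLetters_eq,
    hM.ofLetters_eq, ← sum_Bat (fun l => koszList K (fun i => dg a (Fin.append u v i)) l •
      M.ofLetters (l.map fun i => ((Fin.append u v i).2 : A)))] at h
  rw [bat, letters, letters, ← h]
  refine Finset.sum_congr rfl fun σ _ => ?_
  rw [units_smul_eq (K := K), koszul_eq_koszList, hM.ofLetters_eq, List.map_ofFn]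
  rfl

theorem ellTwo_eq (b : ℤ) (bra : A →ₗ[K] A →ₗ[K] A) : ellTwo a b bra u v =
    toH a 𝒜 (sg K ((b - a + 1) * degWord a u) •
      M.lie (b - a + 1) bra (tens K (letters u)) (tens K (letters v))) := by
  set W := Fin.append u v with hW
  -- Extension by zero to all pairs encodes the condition `σ⁻¹(k) ≤ p < σ⁻¹(k+1)`: at the other
  -- positions a letter becomes `0` and the tensor vanishes.
  let m : Fin (p + q) → Fin (p + q) → A := fun i j =>
    if (i : ℕ) < p ∧ p ≤ (j : ℕ) then
      sg K ((b - a + 1) * dg a (W i)) • bra (W i).2 (W j).2 else 0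
  have h := M.sum_interl_mergeSum (f := fun i => ((W i).2 : A)) (D := fun i => dg a (W i))
    (fun i => hM.letter_mem_gA _) (b - a + 1) bra m
    (u := (List.finRange p).map (Fin.castAdd q)) (v := (List.finRange q).map (Fin.natAdd p))
    (by
      intro i _ k hk
      obtain ⟨k, _, rfl⟩ := List.mem_map.1 hk
      have : ¬ p ≤ ((Fin.castAdd q k : Fin (p + q)) : ℕ) := by simp
      simp only [m, this, and_false, if_false])
    (by
      intro j hj i
      obtain ⟨j, _, rfl⟩ := List.mem_map.1 hj
      have : ¬ ((Fin.natAdd p j : Fin (p + q)) : ℕ) < p := by simp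
      simp only [m, this, false_and, if_false])
    (by
      intro i hi j hj
      obtain ⟨i, _, rfl⟩ := List.mem_map.1 hi
      obtain ⟨j, _, rfl⟩ := List.mem_map.1 hj
      have h1 : ((Fin.castAdd q i : Fin (p + q)) : ℕ) < p := by simp
      have h2 : p ≤ ((Fin.natAdd p j : Fin (p + q)) : ℕ) := by simp
      simp only [m, h1, h2, and_self, if_true])
    pairwise_finRange_append
  rw [map_castAdd u v (fun x => (x.2 : A)), map_natAdd u v (fun x => (x.2 : A)),
    map_castAdd u v (dg a), hM.ofLetters_eq,
    hM.ofLetters_eq, ← sum_Bat (fun l => koszList K (fun i => dg a (W i)) l •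
      M.mergeSum (fun i => ((W i).2 : A)) (fun i => dg a (W i)) (b - a + 1) m l),
    List.sum_ofFn] at h
  rw [degWord, letters, letters, ← h, map_sum, ellTwo]
  refine Finset.sum_congr rfl fun σ _ => ?_
  rw [map_smul, ← sum_mergeSum, map_sum, Finset.smul_sum, Finset.sum_filter, Finset.sum_filter]
  refine Finset.sum_congr rfl fun k _ => ?_
  by_cases h1 : (k.2 : ℕ) = k.1 + 1
  · by_cases h2 : ((σ⁻¹ k.1 : Fin (p + q)) : ℕ) < p ∧ p ≤ ((σ⁻¹ k.2 : Fin (p + q)) : ℕ)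
    · rw [if_pos ⟨h1, h2⟩, if_pos h1, units_smul_eq (K := K), Units.val_mul, Int.cast_mul,
        koszul_eq_koszList, cls_eq_toH, map_smul, smul_smul, hM.ofLetters_eq]
      simp only [m, if_pos h2, ellA, negOnePow_smul_eq (K := K)]
      rfl
    · rw [if_neg (fun h => h2 h.2), if_pos h1]
      simp only [m, if_neg h2, M.ofLetters_append_zero, smul_zero, map_zero]
  · rw [if_neg (fun h => h1 h.1), if_neg h1]

theorem dOne_add_muOne (mul : A →ₗ[K] A →ₗ[K] A) (d : A →ₗ[K] A) {n : ℕ} (w : Fin n → HomEl 𝒜) :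
    dOne a d w + muOne a mul w = toH a 𝒜 (M.diff mul d (tens K (letters w))) := by
  have h := M.diff_ofLetters mul d (f := fun i => ((w i).2 : A)) (D := fun i => dg a (w i))
    (fun i => hM.letter_mem_gA (w i)) (List.finRange n)
  have hid : List.finRange n = List.ofFn (id : Fin n → Fin n) := by simp [List.ofFn_eq_map]
  rw [hM.ofLetters_eq, ← List.ofFn_eq_map, hid, ← sum_letterSum, ← sum_mergeSum] at h
  rw [letters, h, map_add, map_sum, map_sum, dOne, muOne]
  congr 1
  · refine Finset.sum_congr rfl fun k _ => ?_
    rw [negOnePow_smul_eq (K := K), cls_eq_toH, map_smul, hM.ofLetters_eq]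
    rfl
  · refine Finset.sum_congr rfl fun k _ => ?_
    rw [negOnePow_smul_eq (K := K), cls_eq_toH, map_smul, hM.ofLetters_eq, one_mul, muA,
      negOnePow_smul_eq (K := K)]
    rfl

end Formulas

end IsTensorModel
end WordModel

/-! ### Bracket, differential and grading on `H` -/

namespace WordModel

theorem lie_jacobi {T I : Type*} [AddCommGroup T] [Module K T] (M : WordModel K A T I) {c : ℤ}
    {mul bra : A →ₗ[K] A →ₗ[K] A} {d : A →ₗ[K] A} (h : IsDGABAlgebra 1 c M.gA mul bra d)
    {m n p : ℤ} {U V W : T} (hU : U ∈ M.gT m) (hV : V ∈ M.gT n) (hW : W ∈ M.gT p) :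
    sg K ((m + c) * (p + c)) • M.lie c bra (M.lie c bra U V) W +
      sg K ((n + c) * (m + c)) • M.lie c bra (M.lie c bra V W) U +
      sg K ((p + c) * (n + c)) • M.lie c bra (M.lie c bra W U) V = 0 := by
  rw [M.lie_anti h (M.lie_mem h hV hW) hU, M.lie_anti h (M.lie_mem h hW hU) hV,
    M.lie_anti h hW hU, M.lie_lie h hU hV hW]
  simp only [map_smul]
  match_scalars <;>
    (try simp only [mul_add, add_mul, sg_add, sg_sq, mul_comm, mul_left_comm, sg_one, mul_one,
      one_mul]) <;> ring_nf <;>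
    try simp only [sg_pow_two, sg_pow_three, sg_pow_four, sg_pow_five, mul_one, one_mul, sub_self,
      neg_add_cancel, add_neg_cancel]

namespace IsTensorModel

open TensorAlgebra (algebraMapInv)

variable {I : Type*} {M : WordModel K A (TensorAlgebra K A) I} (hM : M.IsTensorModel a 𝒜)
include hM

theorem algebraMapInv_cons (x : A) (U : TensorAlgebra K A) : algebraMapInv (M.cons x U) = 0 := by
  rw [hM.cons_eq, algebraMapInv_ι_mul]

theorem algebraMapInv_lie (c : ℤ) (bra : A →ₗ[K] A →ₗ[K] A) (U V : TensorAlgebra K A) :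
    algebraMapInv (M.lie c bra U V) = 0 := by
  induction M.word.mem_span U using Submodule.span_induction with
  | zero => simp
  | add x y _ _ h1 h2 => simp only [map_add, LinearMap.add_apply, h1, h2, add_zero]
  | smul r x _ h => simp only [map_smul, LinearMap.smul_apply, h, smul_zero]
  | mem x hx =>
  obtain ⟨u, rfl⟩ := hx
  induction M.word.mem_span V using Submodule.span_induction with
  | zero => simp
  | add x y _ _ h1 h2 => simp only [map_add, h1, h2, add_zero]
  | smul r x _ h => simp only [map_smul, h, smul_zero]
  | mem x hx =>
  obtain ⟨v, rfl⟩ := hx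
  rw [lie_word]
  rcases u with _ | ⟨i, u⟩
  · simp [braWord]
  rcases v with _ | ⟨j, v⟩
  · simp [braWord]
  simp only [braWord, map_add, map_smul, hM.algebraMapInv_cons, smul_zero, add_zero]

theorem algebraMapInv_diff (mul : A →ₗ[K] A →ₗ[K] A) (d : A →ₗ[K] A) (U : TensorAlgebra K A) :
    algebraMapInv (M.diff mul d U) = 0 := by
  induction M.word.mem_span U using Submodule.span_induction with
  | zero => simp
  | add x y _ _ h1 h2 => simp only [map_add, h1, h2, add_zero]
  | smul r x _ h => simp only [map_smul, h, smul_zero]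
  | mem x hx =>
  obtain ⟨u, rfl⟩ := hx
  rcases u with _ | ⟨i, u⟩
  · simp
  rw [← M.cons_word, M.diff_cons (M.letter_mem i)]
  rcases u with _ | ⟨j, u⟩
  · simp [hM.algebraMapInv_cons]
  · rw [← M.cons_word, absorb_cons]
    simp only [map_add, map_smul, hM.algebraMapInv_cons, smul_zero, add_zero]

omit hM in
theorem algebraMapInv_tens_letters {n : ℕ} (hn : 1 ≤ n) (w : Fin n → HomEl 𝒜) :
    algebraMapInv (tens K (letters w)) = 0 := by
  obtain ⟨n, rfl⟩ := Nat.exists_eq_add_of_le' hn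
  rw [letters, List.ofFn_succ]
  exact algebraMapInv_of_mem_Tplus (tens_cons_mem _ _)

omit hM in
theorem toH_bat {p q : ℕ} (hp : 1 ≤ p) (hq : 1 ≤ q) (u : Fin p → HomEl 𝒜) (v : Fin q → HomEl 𝒜) :
    toH a 𝒜 (bat a u v) = 0 := by
  have hS : bat a u v ∈ shuffles a 𝒜 := Submodule.subset_span ⟨p, q, u, v, hp, hq, rfl⟩
  have h0 : algebraMapInv (bat a u v) = 0 := by
    rw [bat, map_sum]
    refine Finset.sum_eq_zero fun σ _ => ?_
    rw [units_smul_eq (K := K), map_smul, algebraMapInv_tens_letters (by omega), smul_zero]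
  rw [toH, LinearMap.comp_apply, Submodule.mkQ_apply, Submodule.Quotient.mk_eq_zero]
  change projPlus K A _ ∈ shuffles a 𝒜
  rwa [projPlus_apply, h0, map_zero, sub_zero]

/-- Two nonempty words shuffle to zero in `H`, and the empty word is the unit. Keeping the scalar
parts makes the formula bilinear, so it can be checked on basis words. -/
theorem toH_sh (U V : TensorAlgebra K A) : toH a 𝒜 (M.sh U V) =
    algebraMapInv U • toH a 𝒜 V + algebraMapInv V • toH a 𝒜 U := by
  induction M.word.mem_span U using Submodule.span_induction with
  | zero => simp
  | add x y _ _ h1 h2 =>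
    simp only [map_add, LinearMap.add_apply, h1, h2, add_smul, smul_add]
    abel
  | smul r x _ h =>
    simp only [map_smul, LinearMap.smul_apply, h, smul_add, smul_smul, smul_eq_mul,
      mul_comm r]
  | mem x hx =>
  obtain ⟨u, rfl⟩ := hx
  induction M.word.mem_span V using Submodule.span_induction with
  | zero => simp
  | add x y _ _ h1 h2 =>
    simp only [map_add, h1, h2, add_smul, smul_add]
    abel
  | smul r x _ h =>
    simp only [map_smul, h, smul_add, smul_smul, smul_eq_mul, mul_comm r]
  | mem x hx =>
  obtain ⟨v, rfl⟩ := hx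
  rcases u with _ | ⟨i, u⟩
  · rw [one_sh, hM.one_eq, toH_one]
    simp
  rcases v with _ | ⟨j, v⟩
  · rw [sh_one, hM.one_eq, toH_one]
    simp
  obtain ⟨w, hw, -⟩ := hM.exists_word (i :: u)
  obtain ⟨w', hw', -⟩ := hM.exists_word (j :: v)
  rw [hw, hw', ← hM.bat_eq, toH_bat (by simp) (by simp),
    algebraMapInv_tens_letters (by simp), algebraMapInv_tens_letters (by simp)]
  simp

theorem toH_sh_eq_zero {U V : TensorAlgebra K A} (hU : algebraMapInv U = 0)
    (hV : algebraMapInv V = 0) : toH a 𝒜 (M.sh U V) = 0 := by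
  rw [hM.toH_sh, hU, hV, zero_smul, zero_smul, add_zero]

/-- A linear map that kills shuffle products of homogeneous elements kills `shuffles`. -/
theorem eq_zero_of_mem_shuffles {N : Type*} [AddCommGroup N] [Module K N]
    {F : TensorAlgebra K A →ₗ[K] N}
    (hF : ∀ {m n U V}, U ∈ M.gT m → V ∈ M.gT n → algebraMapInv U = 0 → algebraMapInv V = 0 →
      F (M.sh U V) = 0) {t : TensorAlgebra K A} (ht : t ∈ shuffles a 𝒜) : F t = 0 := by
  have h : shuffles a 𝒜 ≤ LinearMap.ker F := by
    rw [shuffles, Submodule.span_le]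
    rintro _ ⟨p, q, u, v, hp, hq, rfl⟩
    rw [hM.bat_eq]
    exact hF (hM.tens_letters_mem u) (hM.tens_letters_mem v)
      (algebraMapInv_tens_letters hp u) (algebraMapInv_tens_letters hq v)
  exact h ht

theorem gradH_eq (x : ℤ) : gradH a 𝒜 x = (M.gT x).map (toH a 𝒜) := by
  apply le_antisymm
  · rw [gradH, Submodule.span_le]
    rintro _ ⟨n, w, _, rfl, rfl⟩
    exact ⟨_, hM.tens_letters_mem w, (cls_eq_toH _).symm⟩
  · rw [gT, Submodule.map_span, Submodule.span_le]
    rintro _ ⟨_, ⟨l, hl, rfl⟩, rfl⟩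
    have hl : M.wdeg l = x := hl
    rcases l with _ | ⟨i, l⟩
    · rw [hM.one_eq, toH_one]
      exact zero_mem _
    · obtain ⟨w, hw, hd⟩ := hM.exists_word (i :: l)
      exact Submodule.subset_span ⟨_, w, by simp, hd.trans hl, by rw [cls_eq_toH, ← hw]⟩

/-- Shuffle products of homogeneous elements are homogeneous, so rescaling by degree preserves the
relations. It serves twice: indicator functions give the projections to the graded pieces, and `χ x
= (-1)^{c x}` gives the sign that turns `lie` into `ℓ₂`. -/
theorem exists_scaleH (χ : ℤ → K) : ∃ G : H a 𝒜 →ₗ[K] H a 𝒜,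
    ∀ x, ∀ X ∈ gradH a 𝒜 x, G X = χ x • X := by
  obtain ⟨G, hG⟩ := exists_lift (a := a) (𝒜 := 𝒜) ((toH a 𝒜).comp (M.scale χ))
    (by rw [LinearMap.comp_apply, ← hM.one_eq, M.scale_of_mem χ M.one_mem, map_smul, hM.one_eq,
      toH_one, smul_zero])
    (fun t ht => hM.eq_zero_of_mem_shuffles (fun hU hV h1 h2 => by
      rw [LinearMap.comp_apply, M.scale_of_mem χ (M.sh_mem hU hV), map_smul,
        hM.toH_sh_eq_zero h1 h2, smul_zero]) ht)
  refine ⟨G, fun x X hX => ?_⟩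
  rw [hM.gradH_eq] at hX
  obtain ⟨U, hU, rfl⟩ := hX
  rw [hG, LinearMap.comp_apply, M.scale_of_mem χ hU, map_smul]

theorem isInternal_gradH : DirectSum.IsInternal (gradH a 𝒜) := by
  rw [DirectSum.isInternal_submodule_iff_iSupIndep_and_iSup_eq_top]
  constructor
  · intro x
    obtain ⟨G, hG⟩ := hM.exists_scaleH (fun y => if y = x then 1 else 0)
    rw [Submodule.disjoint_def]
    intro X hX hX'
    have h1 : G X = X := by rw [hG x X hX, if_pos rfl, one_smul]
    have h2 : ⨆ y, ⨆ (_ : y ≠ x), gradH a 𝒜 y ≤ LinearMap.ker G := by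
      refine iSup₂_le fun y hy Y hY => ?_
      rw [LinearMap.mem_ker, hG y Y hY, if_neg hy, zero_smul]
    rw [← h1]
    exact h2 hX'
  · rw [eq_top_iff]
    rintro X -
    obtain ⟨U, rfl⟩ := toH_surjective X
    refine M.T_induction (P := fun U => toH a 𝒜 U ∈ ⨆ x, gradH a 𝒜 x) ?_ ?_ ?_ U
    · simp
    · intro U V h1 h2
      rw [map_add]
      exact add_mem h1 h2
    · intro m U hU
      exact Submodule.mem_iSup_of_mem m (hM.gradH_eq m ▸ ⟨U, hU, rfl⟩)

variable {c : ℤ} {mul bra : A →ₗ[K] A →ₗ[K] A} {d : A →ₗ[K] A}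

theorem exists_diffH (h : IsDGABAlgebra 1 c M.gA mul bra d) : ∃ D : H a 𝒜 →ₗ[K] H a 𝒜,
    ∀ U, D (toH a 𝒜 U) = toH a 𝒜 (M.diff mul d U) :=
  exists_lift ((toH a 𝒜).comp (M.diff mul d))
    (by rw [LinearMap.comp_apply, ← hM.one_eq, diff_one, map_zero])
    fun t ht => hM.eq_zero_of_mem_shuffles (fun hU hV h1 h2 => by
      rw [LinearMap.comp_apply, M.diff_sh h hU hV, map_add, map_smul,
        hM.toH_sh_eq_zero (hM.algebraMapInv_diff mul d _) h2,
        hM.toH_sh_eq_zero h1 (hM.algebraMapInv_diff mul d _), smul_zero, add_zero]) ht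

theorem exists_lieH (h : IsDGABAlgebra 1 c M.gA mul bra d) :
    ∃ P : H a 𝒜 →ₗ[K] H a 𝒜 →ₗ[K] H a 𝒜,
      ∀ U V, P (toH a 𝒜 U) (toH a 𝒜 V) = toH a 𝒜 (M.lie c bra U V) := by
  refine exists_lift₂ ((M.lie c bra).compr₂ (toH a 𝒜)) ?_ ?_ ?_ ?_
  · intro t
    rw [LinearMap.compr₂_apply, ← hM.one_eq, one_lie, map_zero]
  · intro t
    rw [LinearMap.compr₂_apply, ← hM.one_eq, lie_one, map_zero]
  · intro s hs t
    refine M.T_induction (P := fun t => (M.lie c bra).compr₂ (toH a 𝒜) s t = 0) (map_zero _)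
      (fun U V h1 h2 => by rw [map_add, h1, h2, add_zero]) (fun p W hW => ?_) t
    -- By the derivation rule, bracketing a shuffle product gives shuffle products whose factors
    -- again have no scalar part, since values of `lie` never have one.
    have e := hM.eq_zero_of_mem_shuffles (F := (toH a 𝒜).comp ((M.lie c bra).flip W))
      (fun hU hV h1 h2 => by
        rw [LinearMap.comp_apply, LinearMap.flip_apply, M.sh_lie h hU hV hW, map_add, map_smul,
          hM.toH_sh_eq_zero h1 (hM.algebraMapInv_lie c bra _ _),
          hM.toH_sh_eq_zero (hM.algebraMapInv_lie c bra _ _) h2, smul_zero, add_zero]) hs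
    rwa [LinearMap.comp_apply, LinearMap.flip_apply, ← LinearMap.compr₂_apply] at e
  · intro t ht s
    refine M.T_induction (P := fun s => (M.lie c bra).compr₂ (toH a 𝒜) s t = 0)
      (by rw [map_zero, LinearMap.zero_apply])
      (fun U V h1 h2 => by rw [map_add, LinearMap.add_apply, h1, h2, add_zero])
      (fun p W hW => ?_) s
    rw [LinearMap.compr₂_apply, ← LinearMap.comp_apply]
    refine hM.eq_zero_of_mem_shuffles (fun hU hV h1 h2 => ?_) ht
    rw [LinearMap.comp_apply, M.lie_sh h hW hU hV, map_add, map_smul,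
      hM.toH_sh_eq_zero h1 (hM.algebraMapInv_lie c bra _ _),
      hM.toH_sh_eq_zero (hM.algebraMapInv_lie c bra _ _) h2, smul_zero, add_zero]

end IsTensorModel

end WordModel

end ABHomotopy

/-! ### The differential graded Lie algebra -/

open ABHomotopy in
theorem proposition4p2 {K : Type*} [Field K] {A : Type*} [AddCommGroup A] [Module K A]
    (a b : ℤ) (𝒜 : ℤ → Submodule K A) (mul bra : A →ₗ[K] A →ₗ[K] A) (d : A →ₗ[K] A)
    (hA : ABHomotopy.IsDGABAlgebra a b 𝒜 mul bra d) :
    ∃ (l₂ : ABHomotopy.H a 𝒜 →ₗ[K] ABHomotopy.H a 𝒜 →ₗ[K] ABHomotopy.H a 𝒜)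
      (D : ABHomotopy.H a 𝒜 →ₗ[K] ABHomotopy.H a 𝒜)
      (l₂' : ABHomotopy.H a 𝒜 →ₗ[K] ABHomotopy.H a 𝒜 →ₗ[K] ABHomotopy.H a 𝒜),
      -- `l₂` and `D = d₁ + μ₁` are given by their formulas on classes of words
      (∀ (p q : ℕ) (u : Fin p → ABHomotopy.HomEl 𝒜) (v : Fin q → ABHomotopy.HomEl 𝒜),
        1 ≤ p → 1 ≤ q →
        l₂ (ABHomotopy.cls a 𝒜 (ABHomotopy.letters u)) (ABHomotopy.cls a 𝒜 (ABHomotopy.letters v))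
          = ABHomotopy.ellTwo a b bra u v) ∧
      (∀ (n : ℕ) (w : Fin n → ABHomotopy.HomEl 𝒜), 1 ≤ n →
        D (ABHomotopy.cls a 𝒜 (ABHomotopy.letters w))
          = ABHomotopy.dOne a d w + ABHomotopy.muOne a mul w) ∧
      -- `l₂'(X, Y) = (-1)^{(a-b-1) x'} l₂(X, Y)`, where `x'` is the degree of `X` in `H[a-b-1]`
      (∀ (x' : ℤ) (X Y : ABHomotopy.H a 𝒜),
        X ∈ ABHomotopy.shift (a - b - 1) (ABHomotopy.gradH a 𝒜) x' →
        l₂' X Y = ((a - b - 1) * x').negOnePow • l₂ X Y) ∧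
      ABHomotopy.IsDGLieAlgebra (ABHomotopy.shift (a - b - 1) (ABHomotopy.gradH a 𝒜)) l₂' D := by
  obtain ⟨I, M, hg, hc, h1⟩ := exists_wordModel a hA.isInternal
  have hM : M.IsTensorModel a 𝒜 := ⟨hg, hc, h1⟩
  set c := b - a + 1 with hc
  have h : IsDGABAlgebra 1 c M.gA mul bra d := hA.shifted hg
  obtain ⟨D, hD⟩ := hM.exists_diffH h
  obtain ⟨P, hP⟩ := hM.exists_lieH h
  obtain ⟨G, hG⟩ := hM.exists_scaleH (fun x => sg K (c * x))
  have hrep {x : ℤ} {X : H a 𝒜} (hX : X ∈ shift (a - b - 1) (gradH a 𝒜) x) :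
      ∃ m U, U ∈ M.gT m ∧ toH a 𝒜 U = X ∧ x = m + c := by
    rw [shift, hM.gradH_eq] at hX
    obtain ⟨U, hU, rfl⟩ := hX
    exact ⟨_, U, hU, rfl, by rw [hc]; ring⟩
  have hmem {m : ℤ} {U : TensorAlgebra K A} (hU : U ∈ M.gT m) {x : ℤ} (hx : x = m + c) :
      toH a 𝒜 U ∈ shift (a - b - 1) (gradH a 𝒜) x := by
    rw [shift, hM.gradH_eq]
    refine ⟨U, ?_, rfl⟩
    rwa [hx, show m + c + (a - b - 1) = m by rw [hc]; ring]
  have hcc : sg K c * sg K c = 1 := sg_mul_self c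
  -- `G` supplies the sign `(-1)^{c dg X}` of `ℓ₂`. Since `a - b - 1 = -c` and `dg X = x' - c`, the
  -- extra sign in `ℓ'₂` leaves the exponent `-c²`, that is the constant `(-1)^c`.
  refine ⟨P.comp G, D, sg K c • P, ?_, ?_, ?_, ?_⟩
  · intro p q u v hp hq
    have hu : toH a 𝒜 (tens K (letters u)) ∈ gradH a 𝒜 (degWord a u) :=
      hM.gradH_eq (degWord a u) ▸ ⟨_, hM.tens_letters_mem u, rfl⟩
    rw [hM.ellTwo_eq, cls_eq_toH, cls_eq_toH, LinearMap.comp_apply, hG _ _ hu, map_smul,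
      LinearMap.smul_apply, hP, map_smul]
  · intro n w _
    rw [hM.dOne_add_muOne, cls_eq_toH, hD]
  · intro x X Y hX
    have hX' : X ∈ gradH a 𝒜 (x + (a - b - 1)) := hX
    rw [negOnePow_smul_eq (K := K), LinearMap.comp_apply, hG _ _ hX', map_smul,
      LinearMap.smul_apply, LinearMap.smul_apply, LinearMap.smul_apply, smul_smul, ← sg_add,
      show (a - b - 1) * x + c * (x + (a - b - 1)) = -(c * c) by rw [hc]; ring, sg_neg, sg_sq]
  · constructor
    · exact isInternal_shift hM.isInternal_gradH (Equiv.addRight (a - b - 1))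
    · intro x y X Y hX hY
      obtain ⟨m, U, hU, rfl, rfl⟩ := hrep hX
      obtain ⟨n, V, hV, rfl, rfl⟩ := hrep hY
      rw [LinearMap.smul_apply, LinearMap.smul_apply, hP]
      exact Submodule.smul_mem _ _ (hmem (M.lie_mem h hU hV) (by ring))
    · intro x X hX
      obtain ⟨m, U, hU, rfl, rfl⟩ := hrep hX
      rw [hD]
      exact hmem (M.diff_mem h hU) (by ring)
    · intro x y X Y hX hY
      obtain ⟨m, U, hU, rfl, rfl⟩ := hrep hX
      obtain ⟨n, V, hV, rfl, rfl⟩ := hrep hY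
      simp only [LinearMap.smul_apply, hP, negOnePow_smul_eq (K := K)]
      rw [M.lie_anti h hU hV, map_smul]
      module
    · intro x y z X Y Z hX hY hZ
      obtain ⟨m, U, hU, rfl, rfl⟩ := hrep hX
      obtain ⟨n, V, hV, rfl, rfl⟩ := hrep hY
      obtain ⟨p, W, hW, rfl, rfl⟩ := hrep hZ
      have e := congrArg (toH a 𝒜) (M.lie_jacobi h hU hV hW)
      simp only [map_add, map_smul, map_zero] at e
      -- Each Jacobi term contains the bracket twice, so the constant `(-1)^c` squares away.
      simp only [LinearMap.smul_apply, map_smul, hP, negOnePow_smul_eq (K := K), smul_smul, hcc,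
        mul_one]
      exact e
    · intro x y X Y hX hY
      obtain ⟨m, U, hU, rfl, rfl⟩ := hrep hX
      obtain ⟨n, V, hV, rfl, rfl⟩ := hrep hY
      simp only [LinearMap.smul_apply, hP, map_smul, hD, negOnePow_smul_eq (K := K)]
      rw [M.diff_lie h hU hV, map_add, map_smul]
      module
    · intro X
      obtain ⟨U, rfl⟩ := toH_surjective X
      rw [hD, hD, M.diff_diff h, map_zero]
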